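/- Let $n\ge 1$, let $\mathbb H^n=\mathbb C^n\times\mathbb R$ be the Heisenberg group with product $(z,t)\cdot(w,s)=(z+w,\,t+s+2\operatorname{Im}(z\cdot\overline w))$ and Lebesgue measure, and let $Q=2n+2$. Write $z_i=x_i+\mathrm{i}y_i$, let $X_i=\partial_{x_i}+2y_i\partial_t$, $Y_i=\partial_{y_i}-2x_i\partial_t$ $(1\le i\le n)$, and let $\nabla_{\mathbb H^n}u=\sum_i (X_iu)X_i+(Y_iu)Y_i$ with $|\nabla_{\mathbb H^n}u|^2=\sum_i (X_iu)^2+(Y_iu)^2$, derivatives being understood in the weak sense. Let $\delta_\lambda(z,t)=(\lambda z,\lambda^2t)$ and $|(z,t)|=(|z|^4+t^2)^{1/4}$. For $T>1$ let $\Omega_T=\{x\in\mathbb H^n : 1\le |x|\le T\}$ and let $X_T$ be the space of all real functions $u\in L^2_{\rm loc}(\mathbb H^n\setminus\{0\})$ with weak derivatives $X_iu,Y_iu\in L^2_{\rm loc}(\mathbb H^n\setminus\{0\})$ for all $i$ such that $u\circ\delta_T=T^{-\frac{Q-2}{2}}u$ almost everywhere, with the norm $\|u\|_{X_T}=\big(\int_{\Omega_T}|\nabla_{\mathbb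 H^n}u|^2\big)^{1/2}$. Then there is a constant $C$, depending only on $n$ and in particular independent of $T$, such that for every $T>1$ and every $u\in X_T$ $$\|u\|_{L^{\frac{2Q}{Q-2}}(\Omega_T)}\le C\,(\log T)^{\frac{Q-2}{2Q}}\left(\frac{T^Q}{T^Q-1}\right)^{1/2}\|u\|_{X_T}.$$ -/

import Mathlib

open MeasureTheory
open scoped ContDiff ENNReal

namespace Heisenberg

/-- The Heisenberg group `ℍⁿ = ℂⁿ × ℝ` as a manifold; its `volume` is Lebesgue measure, which is
the Haar measure of the group law `(z, t) (w, s) = (z + w, t + s + 2 Im (z · w̄))`. -/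
abbrev Heis (n : ℕ) : Type := (Fin n → ℂ) × ℝ

/-- The homogeneous dimension `Q = 2n + 2`. -/
def homDim (n : ℕ) : ℕ := 2 * n + 2

/-- The dilations `δ_r (z, t) = (r z, r² t)`. -/
def dilation {n : ℕ} (r : ℝ) (p : Heis n) : Heis n :=
  (fun i => (r : ℂ) * p.1 i, r ^ 2 * p.2)

/-- The homogeneous norm `|(z, t)| = (|z|⁴ + t²)^{1/4}`, where `|z|² = ∑ |zᵢ|²`. -/
noncomputable def homNorm {n : ℕ} (p : Heis n) : ℝ :=
  ((∑ i, ‖p.1 i‖ ^ 2) ^ 2 + p.2 ^ 2) ^ (1 / 4 : ℝ)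

/-- The closed annulus `Ω_T = {1 ≤ |x| ≤ T}`, a fundamental domain (up to null sets) of `δ_T`. -/
def annulus (n : ℕ) (T : ℝ) : Set (Heis n) :=
  {p | 1 ≤ homNorm p ∧ homNorm p ≤ T}

/-- The horizontal left invariant frame: `Sum.inl i` is `X_i = ∂_{x_i} + 2 y_i ∂_t` and
`Sum.inr i` is `Y_i = ∂_{y_i} - 2 x_i ∂_t`, where `z_i = x_i + i y_i`. -/
noncomputable def frame {n : ℕ} : Fin n ⊕ Fin n → Heis n → Heis n
  | Sum.inl i, p => (Pi.single i 1, 2 * (p.1 i).im)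
  | Sum.inr i, p => (Pi.single i Complex.I, -2 * (p.1 i).re)

/-- The derivative of a (differentiable) function along a field of the horizontal frame. -/
noncomputable def frameDeriv {n : ℕ} (j : Fin n ⊕ Fin n) (φ : Heis n → ℝ) (p : Heis n) : ℝ :=
  fderiv ℝ φ p (frame j p)

/-- `f ∈ L²_loc(U)`. -/
def MemL2loc {n : ℕ} (U : Set (Heis n)) (f : Heis n → ℝ) : Prop :=
  ∀ K : Set (Heis n), IsCompact K → K ⊆ U → MemLp f 2 (volume.restrict K)

/-- `g ∈ L²_loc(U)` is the weak derivative of `u` in `U` along the `j`-th field of the frame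
(all these fields are divergence free). -/
def IsWeakFrameDeriv {n : ℕ} (U : Set (Heis n)) (j : Fin n ⊕ Fin n) (u g : Heis n → ℝ) : Prop :=
  MemL2loc U g ∧
    ∀ φ : Heis n → ℝ, ContDiff ℝ ∞ φ → HasCompactSupport φ → tsupport φ ⊆ U →
      ∫ p, u p * frameDeriv j φ p = -∫ p, g p * φ p

/-- `u ∈ S¹_loc(U)`: the function and its weak horizontal derivatives are in `L²_loc(U)`. -/
def MemS1loc {n : ℕ} (U : Set (Heis n)) (u : Heis n → ℝ) : Prop :=
  MemL2loc U u ∧ ∀ j, ∃ g, IsWeakFrameDeriv U j u g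

open Classical in
/-- The components of the weak subriemannian gradient of `u` in `U` with respect to the
orthonormal frame (zero if the weak derivative does not exist). -/
noncomputable def weakGrad {n : ℕ} (U : Set (Heis n)) (u : Heis n → ℝ) (j : Fin n ⊕ Fin n) :
    Heis n → ℝ :=
  if h : ∃ g, IsWeakFrameDeriv U j u g then h.choose else 0

/-- The space `X_T` of the functions in `S¹_loc(ℍⁿ ∖ {0})` with
`u ∘ δ_T = T^{-(Q-2)/2} u` almost everywhere. -/
def XSpace (n : ℕ) (T : ℝ) : Set (Heis n → ℝ) :=
  {u | MemS1loc {0}ᶜ u ∧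
    ∀ᵐ p : Heis n, u (dilation T p) = T ^ (-(((homDim n : ℝ) - 2) / 2)) * u p}

/-- The scalar product `⟨u, v⟩ = ∫_{Ω_T} ∇u · ∇v` of `X_T`. -/
noncomputable def XInner {n : ℕ} (T : ℝ) (u v : Heis n → ℝ) : ℝ :=
  ∫ p in annulus n T, ∑ j, weakGrad {0}ᶜ u j p * weakGrad {0}ᶜ v j p

/-- The norm of `X_T`. -/
noncomputable def XNorm {n : ℕ} (T : ℝ) (u : Heis n → ℝ) : ℝ :=
  √(XInner T u u)

theorem MemL2loc.locallyIntegrableOn {n : ℕ} {U : Set (Heis n)} (hU : IsOpen U)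
    {f : Heis n → ℝ} (hf : MemL2loc U f) : LocallyIntegrableOn f U := by
  rw [locallyIntegrableOn_iff hU.isLocallyClosed]
  intro K hKU hK
  haveI : IsFiniteMeasure ((volume : Measure (Heis n)).restrict K) :=
    ⟨by simpa using hK.measure_lt_top⟩
  exact (hf K hK hKU).integrable (by norm_num)

/-- Weak derivatives are unique up to null sets, so that `weakGrad` and `XNorm` do not depend on
the choice made. -/
theorem IsWeakFrameDeriv.ae_eq {n : ℕ} {U : Set (Heis n)} (hU : IsOpen U) {j : Fin n ⊕ Fin n}
    {u g h : Heis n → ℝ} (hg : IsWeakFrameDeriv U j u g) (hh : IsWeakFrameDeriv U j u h) :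
    ∀ᵐ p, p ∈ U → g p = h p := by
  have hgi := hg.1.locallyIntegrableOn hU
  have hhi := hh.1.locallyIntegrableOn hU
  have key := hU.ae_eq_zero_of_integral_contDiff_smul_eq_zero (hgi.sub hhi) (by
    intro φ hφ hc hs
    have hi : ∀ f : Heis n → ℝ, LocallyIntegrableOn f U → Integrable fun p => f p * φ p := by
      intro f hf
      have h1 : IntegrableOn f (tsupport φ) := hf.integrableOn_compact_subset hs hc
      have h2 : IntegrableOn (fun p => f p * φ p) (tsupport φ) :=
        h1.mul_continuousOn hφ.continuous.continuousOn hc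
      refine (integrableOn_iff_integrable_of_support_subset ?_).1 h2
      intro p hp
      exact subset_tsupport φ (fun h0 => hp (by simp [h0]))
    have e : (fun p => φ p • (g - h) p) = fun p => g p * φ p - h p * φ p := by
      funext p; simp [mul_sub, mul_comm]
    rw [e, integral_sub (hi g hgi) (hi h hhi)]
    have := hg.2 φ hφ hc hs
    have := hh.2 φ hφ hc hs
    linarith)
  filter_upwards [key] with p hp hpU
  exact sub_eq_zero.1 (hp hpU)

end Heisenberg

/-! The argument has two halves: a Folland–Stein inequality on the whole group, proved from scratch,
and its transfer to functions homogeneous under a single dilation.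

On the group, a right difference of `f` along a horizontal vector `(w, 0)` has `L²` norm at most
`‖w‖` times that of the horizontal gradient. A commutator of two horizontal vectors moves in the
central direction, so every point of a box of radius `r` is a product of five horizontal steps of
length at most `r` (`exists_horizontal_factorization`). Averaging the resulting differences over a
box with twice the volume of the support gives a weak-type estimate for level sets
(`volume_level_le`). Maz'ya truncation at the levels `2 ^ k` turns it into the strong inequality for
`C¹` functions (`sobolev_contDiff`). Averaging left translates commutes with the left invariant
frame, so mollification extends this to weak derivatives (`sobolev_weak`).

For `u ∈ X_T` the densities `|u|^q`, with `q = 2Q/(Q-2)`, and `|∇u|²` have degree `-Q` under `δ_T`,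
so every period carries the same integrals `M` and `ν`. Put `l = K log T` and multiply `u` by a
cutoff in the logarithm of `|x|` which is one on the middle `K` of `3K` periods; its gradient is
`O(1 / (l |x|))`. By Hölder, the error `l⁻² ∫ u² / |x|²` is at most a constant times `l⁻¹
(3KM)^{2/q}`. Once `l` exceeds a constant `A` depending on `n` alone, it is absorbed into the left
side `(KM)^{2/q}`, leaving `M^{2/q} ≤ C K^{2/Q} ν` (`sobolev_fundamental_shell`).

With `K = ⌈A / log T⌉`, what remains is an elementary comparison of `K^{1/Q}` with the stated
function of `T` (`ceil_rpow_le`). Small `log T` produces the factor `(T^Q / (T^Q - 1))^{1/2}`; for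
large `log T` a single period suffices. -/

namespace Heisenberg

open Set Filter Topology

variable {n : ℕ}

/-! ### The group law and the translation invariance of Lebesgue measure -/

/-- The symplectic form `Im (a · b̄)` on `ℂⁿ`. -/
def sympl (a b : Fin n → ℂ) : ℝ := ∑ i, ((a i).im * (b i).re - (a i).re * (b i).im)

/-- The product of the Heisenberg group. -/
def hmul (p q : Heis n) : Heis n := (p.1 + q.1, p.2 + q.2 + 2 * sympl p.1 q.1)

theorem sympl_add_left (a b c : Fin n → ℂ) : sympl (a + b) c = sympl a c + sympl b c := by
  simp only [sympl, ← Finset.sum_add_distrib]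
  exact Finset.sum_congr rfl fun i _ => by simp; ring

theorem sympl_comm (a b : Fin n → ℂ) : sympl a b = -sympl b a := by
  simp only [sympl, ← Finset.sum_neg_distrib]
  exact Finset.sum_congr rfl fun i _ => by ring

theorem sympl_add_right (a b c : Fin n → ℂ) : sympl a (b + c) = sympl a b + sympl a c := by
  rw [sympl_comm, sympl_add_left, sympl_comm b, sympl_comm c]; ring

theorem sympl_smul_left (s : ℝ) (a b : Fin n → ℂ) : sympl (s • a) b = s * sympl a b := by
  simp only [sympl, Finset.mul_sum]
  exact Finset.sum_congr rfl fun i _ => by simp; ring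

theorem sympl_smul_right (s : ℝ) (a b : Fin n → ℂ) : sympl a (s • b) = s * sympl a b := by
  rw [sympl_comm, sympl_smul_left, sympl_comm b]; ring

theorem sympl_neg_left (a b : Fin n → ℂ) : sympl (-a) b = -sympl a b := by
  simpa using sympl_smul_left (-1) a b

theorem sympl_neg_right (a b : Fin n → ℂ) : sympl a (-b) = -sympl a b := by
  simpa using sympl_smul_right (-1) a b

@[simp] theorem sympl_self (a : Fin n → ℂ) : sympl a a = 0 := by
  have := sympl_comm a a; linarith

@[simp] theorem sympl_zero_left (a : Fin n → ℂ) : sympl 0 a = 0 := by simp [sympl]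

@[simp] theorem sympl_zero_right (a : Fin n → ℂ) : sympl a 0 = 0 := by simp [sympl]

theorem hmul_assoc (p q r : Heis n) : hmul (hmul p q) r = hmul p (hmul q r) := by
  refine Prod.ext (add_assoc _ _ _) ?_
  simp only [hmul, sympl_add_left, sympl_add_right]; ring

@[simp] theorem hmul_zero (p : Heis n) : hmul p 0 = p := by simp [hmul]

@[simp] theorem zero_hmul (p : Heis n) : hmul 0 p = p := by simp [hmul]

@[simp] theorem neg_hmul_self (p : Heis n) : hmul (-p) p = 0 := by
  simp [hmul, sympl_neg_left]

@[simp] theorem hmul_neg_self (p : Heis n) : hmul p (-p) = 0 := by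
  simp [hmul, sympl_neg_right]

theorem neg_hmul (p q : Heis n) : -hmul p q = hmul (-q) (-p) := by
  refine Prod.ext ?_ ?_
  · simp [hmul, add_comm]
  · simp only [hmul, Prod.snd_neg, Prod.fst_neg, sympl_neg_left, sympl_neg_right]
    rw [sympl_comm q.1]; ring

theorem contDiff_sympl {k : WithTop ℕ∞} :
    ContDiff ℝ k (fun a : (Fin n → ℂ) × (Fin n → ℂ) => sympl a.1 a.2) := by
  unfold sympl
  refine ContDiff.sum fun i _ => ?_
  have h1 : ContDiff ℝ k fun a : (Fin n → ℂ) × (Fin n → ℂ) => a.1 i :=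
    (contDiff_apply ℝ ℂ i).comp contDiff_fst
  have h2 : ContDiff ℝ k fun a : (Fin n → ℂ) × (Fin n → ℂ) => a.2 i :=
    (contDiff_apply ℝ ℂ i).comp contDiff_snd
  have hr : ContDiff ℝ k Complex.re := Complex.reCLM.contDiff
  have hi : ContDiff ℝ k Complex.im := Complex.imCLM.contDiff
  exact ((hi.comp h1).mul (hr.comp h2)).sub ((hr.comp h1).mul (hi.comp h2))

theorem contDiff_hmul {k : WithTop ℕ∞} :
    ContDiff ℝ k (fun a : Heis n × Heis n => hmul a.1 a.2) := by
  unfold hmul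
  have h1 : ContDiff ℝ k fun a : Heis n × Heis n => a.1.1 := contDiff_fst.comp contDiff_fst
  have h2 : ContDiff ℝ k fun a : Heis n × Heis n => a.2.1 := contDiff_fst.comp contDiff_snd
  have h3 : ContDiff ℝ k fun a : Heis n × Heis n => a.1.2 := contDiff_snd.comp contDiff_fst
  have h4 : ContDiff ℝ k fun a : Heis n × Heis n => a.2.2 := contDiff_snd.comp contDiff_snd
  exact (h1.add h2).prodMk ((h3.add h4).add
    (contDiff_const.mul (contDiff_sympl.comp (h1.prodMk h2))))

theorem _root_.ContDiff.hmul {E : Type*} [NormedAddCommGroup E] [NormedSpace ℝ E]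
    {k : WithTop ℕ∞} {f g : E → Heis n} (hf : ContDiff ℝ k f) (hg : ContDiff ℝ k g) :
    ContDiff ℝ k fun x => hmul (f x) (g x) :=
  contDiff_hmul.comp (hf.prodMk hg)

theorem continuous_hmul : Continuous (fun a : Heis n × Heis n => hmul a.1 a.2) :=
  (contDiff_hmul (k := 0)).continuous

theorem _root_.Continuous.hmul {α : Type*} [TopologicalSpace α]
    {f g : α → Heis n} (hf : Continuous f) (hg : Continuous g) :
    Continuous fun x => hmul (f x) (g x) :=
  continuous_hmul.comp (hf.prodMk hg)

theorem _root_.Measurable.hmul {α : Type*} [MeasurableSpace α]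
    {f g : α → Heis n} (hf : Measurable f) (hg : Measurable g) :
    Measurable fun x => hmul (f x) (g x) :=
  continuous_hmul.measurable.comp (hf.prodMk hg)

/-- The map is a shear: a translation in `z`, followed for each fixed `z` by a translation in `t`.
-/
theorem measurePreserving_hmul_left (p : Heis n) :
    MeasurePreserving (fun x : Heis n => hmul p x) := by
  refine MeasurePreserving.skew_product (measurePreserving_add_left volume p.1)
    (g := fun z t => p.2 + t + 2 * sympl p.1 z) ?_ ?_
  · have h : Continuous fun x : Heis n => (hmul p x).2 :=
      continuous_snd.comp (continuous_const.hmul continuous_id)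
    exact h.measurable
  · refine Eventually.of_forall fun z => ?_
    have h := (measurePreserving_add_left (volume : Measure ℝ) (p.2 + 2 * sympl p.1 z)).map_eq
    rw [← h]
    congr 1
    funext t; ring

theorem measurePreserving_hmul_right (p : Heis n) :
    MeasurePreserving (fun x : Heis n => hmul x p) := by
  refine MeasurePreserving.skew_product (measurePreserving_add_right volume p.1)
    (g := fun z t => t + p.2 + 2 * sympl z p.1) ?_ ?_
  · have h : Continuous fun x : Heis n => (hmul x p).2 :=
      continuous_snd.comp (continuous_id.hmul continuous_const)
    exact h.measurable
  · refine Eventually.of_forall fun z => ?_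
    have h := (measurePreserving_add_left (volume : Measure ℝ) (p.2 + 2 * sympl z p.1)).map_eq
    rw [← h]
    congr 1
    funext t; ring

/-- Left translation as a homeomorphism. -/
def hmulLeft (p : Heis n) : Heis n ≃ₜ Heis n where
  toFun x := hmul p x
  invFun x := hmul (-p) x
  left_inv x := by simp [← hmul_assoc]
  right_inv x := by simp [← hmul_assoc]
  continuous_toFun := continuous_const.hmul continuous_id
  continuous_invFun := continuous_const.hmul continuous_id

/-- Right translation as a homeomorphism. -/
def hmulRight (p : Heis n) : Heis n ≃ₜ Heis n where
  toFun x := hmul x p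
  invFun x := hmul x (-p)
  left_inv x := by simp [hmul_assoc]
  right_inv x := by simp [hmul_assoc]
  continuous_toFun := continuous_id.hmul continuous_const
  continuous_invFun := continuous_id.hmul continuous_const

theorem measurableEmbedding_hmul_left (p : Heis n) :
    MeasurableEmbedding (fun x : Heis n => hmul p x) :=
  (hmulLeft p).measurableEmbedding

theorem measurableEmbedding_hmul_right (p : Heis n) :
    MeasurableEmbedding (fun x : Heis n => hmul x p) :=
  (hmulRight p).measurableEmbedding

theorem lintegral_hmul_right (F : Heis n → ℝ≥0∞) (p : Heis n) :
    ∫⁻ x, F (hmul x p) = ∫⁻ x, F x :=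
  (measurePreserving_hmul_right p).lintegral_comp_emb (measurableEmbedding_hmul_right p) F

theorem lintegral_hmul_left (F : Heis n → ℝ≥0∞) (p : Heis n) :
    ∫⁻ x, F (hmul p x) = ∫⁻ x, F x :=
  (measurePreserving_hmul_left p).lintegral_comp_emb (measurableEmbedding_hmul_left p) F

/-! ### Dilations -/

theorem dilation_eq (r : ℝ) (p : Heis n) : dilation r p = (r • p.1, r ^ 2 • p.2) := by
  refine Prod.ext ?_ ?_
  · funext i; simp [dilation]
  · simp [dilation]

theorem contDiff_dilation (r : ℝ) {k : WithTop ℕ∞} :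
    ContDiff ℝ k (dilation r : Heis n → Heis n) := by
  rw [show (dilation r : Heis n → Heis n) = fun p => (r • p.1, r ^ 2 • p.2) from
    funext (dilation_eq r)]
  fun_prop

theorem dilation_dilation (r s : ℝ) (p : Heis n) :
    dilation r (dilation s p) = dilation (r * s) p := by
  simp only [dilation_eq, smul_smul, mul_pow]

theorem dilation_one (p : Heis n) : dilation 1 p = p := by simp [dilation_eq]

/-- The dilation by `r ≠ 0` as a homeomorphism. -/
noncomputable def dilationHomeomorph (r : ℝ) (hr : r ≠ 0) : Heis n ≃ₜ Heis n where
  toFun := dilation r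
  invFun := dilation r⁻¹
  left_inv x := by simp [dilation_dilation, hr, dilation_one]
  right_inv x := by simp [dilation_dilation, hr, dilation_one]
  continuous_toFun := (contDiff_dilation (k := 0) r).continuous
  continuous_invFun := (contDiff_dilation (k := 0) r⁻¹).continuous

theorem map_dilation (r : ℝ) (hr : 0 < r) :
    Measure.map (dilation r) (volume : Measure (Heis n)) =
      ENNReal.ofReal (r ^ homDim n)⁻¹ • volume := by
  have h1 := Measure.map_addHaar_smul (volume : Measure (Fin n → ℂ)) hr.ne'
  have h2 := Measure.map_addHaar_smul (volume : Measure ℝ) (pow_pos hr 2).ne'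
  have h3 := Measure.map_prod_map (volume : Measure (Fin n → ℂ)) (volume : Measure ℝ)
    (f := (r • ·)) (g := (r ^ 2 • ·)) (measurable_const_smul r) (measurable_const_smul (r ^ 2))
  have h4 : (dilation r : Heis n → Heis n) = Prod.map (r • ·) (r ^ 2 • ·) := by
    funext p; rw [dilation_eq]; rfl
  rw [h4, Measure.volume_eq_prod, ← h3, h1, h2, Measure.prod_smul_left, Measure.prod_smul_right,
    smul_smul, ← ENNReal.ofReal_mul (abs_nonneg _)]
  congr 2
  rw [abs_of_pos (by positivity), abs_of_pos (by positivity), ← mul_inv]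
  congr 1
  simp [homDim, Module.finrank_pi_fintype, pow_add, mul_comm]

theorem measurableEmbedding_dilation (r : ℝ) (hr : 0 < r) :
    MeasurableEmbedding (dilation r : Heis n → Heis n) :=
  (dilationHomeomorph r hr.ne').measurableEmbedding

theorem lintegral_dilation (r : ℝ) (hr : 0 < r) (F : Heis n → ℝ≥0∞) :
    ∫⁻ x, F (dilation r x) = ENNReal.ofReal (r ^ homDim n)⁻¹ * ∫⁻ x, F x := by
  rw [← (measurableEmbedding_dilation r hr).lintegral_map F, map_dilation r hr, lintegral_smul_measure, smul_eq_mul]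

theorem integral_dilation (r : ℝ) (hr : 0 < r) (F : Heis n → ℝ) :
    ∫ x, F (dilation r x) = (r ^ homDim n)⁻¹ * ∫ x, F x := by
  rw [← (measurableEmbedding_dilation r hr).integral_map F, map_dilation r hr, integral_smul_measure, smul_eq_mul, ENNReal.toReal_ofReal (by positivity)]

/-- The box `{|z_i| ≤ r, |t| ≤ r²}`. -/
def box (n : ℕ) (r : ℝ) : Set (Heis n) := Metric.closedBall 0 r ×ˢ Metric.closedBall 0 (r ^ 2)

theorem measurableSet_box (r : ℝ) : MeasurableSet (box n r) :=
  measurableSet_closedBall.prod measurableSet_closedBall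

theorem volume_box (n : ℕ) :
    ∃ c : ℝ, 0 < c ∧ ∀ r : ℝ, 0 ≤ r → volume (box n r) = ENNReal.ofReal (c * r ^ homDim n) := by
  have hb : volume (Metric.ball (0 : Fin n → ℂ) 1) ≠ ⊤ := measure_ball_lt_top.ne
  have hb0 : volume (Metric.ball (0 : Fin n → ℂ) 1) ≠ 0 :=
    (Metric.measure_ball_pos _ _ one_pos).ne'
  refine ⟨2 * (volume (Metric.ball (0 : Fin n → ℂ) 1)).toReal,
    mul_pos two_pos (ENNReal.toReal_pos hb0 hb), fun r hr => ?_⟩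
  rw [box, Measure.volume_eq_prod, Measure.prod_prod, Measure.addHaar_closedBall _ _ hr,
    Real.volume_closedBall]
  conv_lhs => rw [← ENNReal.ofReal_toReal hb]
  rw [← ENNReal.ofReal_mul (by positivity), ← ENNReal.ofReal_mul (by positivity)]
  congr 1
  simp only [homDim, Module.finrank_pi_fintype, Complex.finrank_real_complex, Finset.sum_const, Finset.card_univ,
    Fintype.card_fin, smul_eq_mul]
  ring

/-! ### Right differences and the horizontal gradient -/

/-- The `ℓ¹` length of the horizontal gradient of a differentiable function. -/
noncomputable def hgrad (f : Heis n → ℝ) (x : Heis n) : ℝ≥0∞ := ∑ j, ‖frameDeriv j f x‖ₑ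

theorem frame_combination (w : Fin n → ℂ) (x : Heis n) :
    ((w, 2 * sympl x.1 w) : Heis n) =
      ∑ i, ((w i).re • frame (Sum.inl i) x + (w i).im • frame (Sum.inr i) x) := by
  refine Prod.ext ?_ ?_
  · rw [Prod.fst_sum]
    funext k
    rw [Finset.sum_apply, Finset.sum_eq_single k]
    · simp [frame]
    · intro i _ hik
      simp [frame, Pi.single_eq_of_ne hik.symm]
    · simp
  · simp only [Prod.snd_sum, frame, sympl, Finset.mul_sum, Prod.snd_add, Prod.smul_snd, smul_eq_mul]
    exact Finset.sum_congr rfl fun i _ => by ring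

/-- The coefficients of a horizontal vector in the frame are the real and imaginary parts of the `w
i`, each bounded by the sup norm of `w`; this pairs with the `ℓ¹` length used in `hgrad`. -/
theorem enorm_apply_horizontal_le (L : Heis n →L[ℝ] ℝ) (w : Fin n → ℂ) (x : Heis n) :
    ‖L (w, 2 * sympl x.1 w)‖ₑ ≤ ‖w‖ₑ * ∑ j, ‖L (frame j x)‖ₑ := by
  have hw : ∀ (c : ℝ) (i : Fin n), ‖c‖ ≤ ‖w i‖ → ‖c‖ₑ ≤ ‖w‖ₑ := fun c i hc => by
    rw [← ofReal_norm, ← ofReal_norm]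
    exact ENNReal.ofReal_le_ofReal (hc.trans (norm_le_pi_norm w i))
  rw [frame_combination, map_sum, Fintype.sum_sum_type, ← Finset.sum_add_distrib, Finset.mul_sum]
  refine (enorm_sum_le _ _).trans (Finset.sum_le_sum fun i _ => ?_)
  rw [map_add, map_smul, map_smul, mul_add]
  refine (enorm_add_le _ _).trans ?_
  rw [enorm_smul, enorm_smul]
  gcongr
  · exact hw _ i (Complex.abs_re_le_norm _)
  · exact hw _ i (Complex.abs_im_le_norm _)

/-- The line `s ↦ x · (s w, 0)` is an integral curve of a left invariant horizontal field: its
constant velocity is also the value of the field at the moving point, because `sympl w w = 0`. -/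
theorem hasDerivAt_hmul_line {f : Heis n → ℝ} (hf : Differentiable ℝ f) (x : Heis n)
    (w : Fin n → ℂ) (s : ℝ) :
    HasDerivAt (fun s : ℝ => f (hmul x (s • w, 0)))
      (fderiv ℝ f (hmul x (s • w, 0)) (w, 2 * sympl (hmul x (s • w, 0)).1 w)) s := by
  have h1 : HasDerivAt (fun s : ℝ => hmul x (s • w, 0)) (w, 2 * sympl x.1 w) s := by
    simp only [hmul, sympl_smul_right]
    have ha : HasDerivAt (fun s : ℝ => x.1 + s • w) w s := by
      simpa using ((hasDerivAt_id s).smul_const w).const_add x.1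
    have hb : HasDerivAt (fun s : ℝ => x.2 + 0 + 2 * (s * sympl x.1 w)) (2 * sympl x.1 w) s := by
      simpa using (((hasDerivAt_id s).mul_const (sympl x.1 w)).const_mul 2).const_add (x.2 + 0)
    exact ha.prodMk hb
  have h2 : sympl (hmul x (s • w, 0)).1 w = sympl x.1 w := by
    simp [hmul, sympl_add_left, sympl_smul_left]
  rw [h2]
  exact (hf _).hasFDerivAt.comp_hasDerivAt s h1

theorem sq_lintegral_le {α : Type*} [MeasurableSpace α] (μ : Measure α) [IsProbabilityMeasure μ]
    {g : α → ℝ≥0∞} (hg : AEMeasurable g μ) : (∫⁻ a, g a ∂μ) ^ 2 ≤ ∫⁻ a, g a ^ 2 ∂μ := by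
  have h := ENNReal.lintegral_mul_le_Lp_mul_Lq μ Real.HolderConjugate.two_two hg
    (aemeasurable_const (b := (1 : ℝ≥0∞)))
  simp only [Pi.mul_apply, mul_one, ENNReal.one_rpow, lintegral_const, measure_univ] at h
  calc (∫⁻ a, g a ∂μ) ^ 2 ≤ ((∫⁻ a, g a ^ (2 : ℝ) ∂μ) ^ (1 / 2 : ℝ)) ^ 2 := by gcongr
    _ = _ := by
      rw [← ENNReal.rpow_natCast, ← ENNReal.rpow_mul]
      norm_num

theorem sq_eLpNorm_two {α : Type*} [MeasurableSpace α] (μ : Measure α) (g : α → ℝ) :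
    eLpNorm g 2 μ ^ 2 = ∫⁻ a, ‖g a‖ₑ ^ 2 ∂μ := by
  have h := eLpNorm_nnreal_pow_eq_lintegral (f := g) (μ := μ) (p := 2) two_ne_zero
  simpa using h

theorem continuous_frame (j : Fin n ⊕ Fin n) : Continuous (frame j : Heis n → Heis n) := by
  cases j <;> (unfold frame; fun_prop)

theorem continuous_frameDeriv {f : Heis n → ℝ} (hf : ContDiff ℝ 1 f) (j : Fin n ⊕ Fin n) :
    Continuous (frameDeriv j f) :=
  (hf.continuous_fderiv one_ne_zero).clm_apply (continuous_frame j)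

theorem continuous_hgrad {f : Heis n → ℝ} (hf : ContDiff ℝ 1 f) : Continuous (hgrad f) :=
  continuous_finsetSum _ fun j _ => (continuous_frameDeriv hf j).enorm

/-- Write the difference as an integral over the horizontal segment, apply Jensen in `s`, exchange
the integrals, and use right invariance of the measure for each fixed `s`. -/
theorem lintegral_sq_horizontal_difference_le {f : Heis n → ℝ} (hf : ContDiff ℝ 1 f)
    (w : Fin n → ℂ) :
    ∫⁻ x, ‖f (hmul x (w, 0)) - f x‖ₑ ^ 2 ≤ ‖w‖ₑ ^ 2 * ∫⁻ x, hgrad f x ^ 2 := by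
  have hline : Continuous fun a : Heis n × ℝ => hmul a.1 ((a.2 • w, 0) : Heis n) :=
    continuous_fst.hmul (by fun_prop)
  have hG : Continuous fun a : Heis n × ℝ => hgrad f (hmul a.1 (a.2 • w, 0)) :=
    (continuous_hgrad hf).comp hline
  have : IsProbabilityMeasure (volume.restrict (Ioc (0 : ℝ) 1)) := ⟨by simp⟩
  have key : ∀ x, ‖f (hmul x (w, 0)) - f x‖ₑ ^ 2 ≤
      ∫⁻ s in Ioc (0 : ℝ) 1, ‖w‖ₑ ^ 2 * hgrad f (hmul x (s • w, 0)) ^ 2 := by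
    intro x
    have hd := hasDerivAt_hmul_line (hf.differentiable one_ne_zero) x w
    have hx : Continuous fun s : ℝ => hmul x ((s • w, 0) : Heis n) :=
      continuous_const.hmul (by fun_prop)
    have hc : Continuous fun s : ℝ =>
        fderiv ℝ f (hmul x (s • w, 0)) (w, 2 * sympl (hmul x (s • w, 0)).1 w) := by
      refine ((hf.continuous_fderiv one_ne_zero).comp hx).clm_apply ?_
      have : Continuous fun s : ℝ => sympl (hmul x ((s • w, 0) : Heis n)).1 w :=
        (contDiff_sympl (k := 0)).continuous.comp
          ((continuous_fst.comp hx).prodMk continuous_const)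
      fun_prop
    have hFTC := intervalIntegral.integral_eq_sub_of_hasDerivAt (a := 0) (b := 1)
      (fun s _ => hd s) (hc.intervalIntegrable 0 1)
    have h0 : hmul x (((0 : ℝ) • w, 0) : Heis n) = x := by
      rw [zero_smul]; exact hmul_zero x
    rw [one_smul, h0, intervalIntegral.integral_of_le zero_le_one] at hFTC
    rw [← hFTC]
    calc _ ≤ (∫⁻ s in Ioc (0 : ℝ) 1, ‖w‖ₑ * hgrad f (hmul x (s • w, 0))) ^ 2 := by
          gcongr
          refine (enorm_integral_le_lintegral_enorm _).trans (lintegral_mono fun s => ?_)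
          exact enorm_apply_horizontal_le _ _ _
      _ ≤ ∫⁻ s in Ioc (0 : ℝ) 1, (‖w‖ₑ * hgrad f (hmul x (s • w, 0))) ^ 2 :=
          sq_lintegral_le _ (((continuous_hgrad hf).comp hx).measurable.const_mul _).aemeasurable
      _ = _ := by simp only [mul_pow]
  calc _ ≤ ∫⁻ x, ∫⁻ s in Ioc (0 : ℝ) 1, ‖w‖ₑ ^ 2 * hgrad f (hmul x (s • w, 0)) ^ 2 :=
        lintegral_mono key
    _ = ∫⁻ s in Ioc (0 : ℝ) 1, ∫⁻ x, ‖w‖ₑ ^ 2 * hgrad f (hmul x (s • w, 0)) ^ 2 :=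
        lintegral_lintegral_swap ((hG.measurable.pow_const 2).const_mul _).aemeasurable
    _ = ∫⁻ s in Ioc (0 : ℝ) 1, ‖w‖ₑ ^ 2 * ∫⁻ x, hgrad f x ^ 2 := by
        refine lintegral_congr fun s => ?_
        rw [lintegral_const_mul', lintegral_hmul_right (fun x => hgrad f x ^ 2)]
        exact ENNReal.pow_ne_top enorm_ne_top
    _ = _ := by simp

/-- The `L²` norm of a right difference. -/
noncomputable def diffNorm (f : Heis n → ℝ) (p : Heis n) : ℝ≥0∞ :=
  eLpNorm (fun x => f (hmul x p) - f x) 2 volume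

/-- Split at the intermediate point `x · p`. The increment by `q` starting there has the same norm
as the one starting at `x`, by right invariance. -/
theorem diffNorm_hmul_le {f : Heis n → ℝ} (hf : Continuous f) (p q : Heis n) :
    diffNorm f (hmul p q) ≤ diffNorm f p + diffNorm f q := by
  have hm : ∀ r : Heis n, Continuous fun x => f (hmul x r) := fun r =>
    hf.comp (continuous_id.hmul continuous_const)
  have h1 : (fun x => f (hmul x (hmul p q)) - f x) =
      (fun x => f (hmul (hmul x p) q) - f (hmul x p)) + fun x => f (hmul x p) - f x := by
    funext x; simp [hmul_assoc]
  have h2 : eLpNorm (fun x => f (hmul (hmul x p) q) - f (hmul x p)) 2 volume = diffNorm f q :=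
    eLpNorm_comp_measurePreserving (g := fun x => f (hmul x q) - f x)
      ((hm q).sub hf).aestronglyMeasurable (measurePreserving_hmul_right p)
  unfold diffNorm at h2 ⊢
  rw [h1, add_comm (eLpNorm _ _ _), ← h2]
  refine eLpNorm_add_le ?_ ((hm p).sub hf).aestronglyMeasurable one_le_two
  exact (((hm q).sub hf).comp (continuous_id.hmul continuous_const)).aestronglyMeasurable

theorem diffNorm_horizontal_le {f : Heis n → ℝ} (hf : ContDiff ℝ 1 f) (w : Fin n → ℂ) :
    diffNorm f (w, 0) ≤ ‖w‖ₑ * (∫⁻ x, hgrad f x ^ 2) ^ (1 / 2 : ℝ) := by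
  have h := lintegral_sq_horizontal_difference_le hf w
  rw [← sq_eLpNorm_two] at h
  have h2 : ‖w‖ₑ ^ 2 * ∫⁻ x, hgrad f x ^ 2 = (‖w‖ₑ * (∫⁻ x, hgrad f x ^ 2) ^ (1 / 2 : ℝ)) ^ 2 := by
    rw [mul_pow, ← ENNReal.rpow_natCast ((∫⁻ x, hgrad f x ^ 2) ^ (1 / 2 : ℝ)), ← ENNReal.rpow_mul]
    norm_num
  rw [h2] at h
  exact (ENNReal.pow_le_pow_left_iff two_ne_zero).1 h

/-- The commutator of `(a, 0)` and `(b, 0)` is the central element `(0, 4 sympl a b)`. Taking `a`,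
`b` in one complex coordinate, of size `√|t| / 2` and with the sign of `t` put into `b`, makes it
`(0, t)`. -/
theorem exists_horizontal_factorization (hn : 1 ≤ n) {r : ℝ} (hr : 0 ≤ r) {p : Heis n}
    (hp : p ∈ box n r) :
    ∃ a b : Fin n → ℂ, ‖a‖ ≤ r ∧ ‖b‖ ≤ r ∧ ‖p.1‖ ≤ r ∧
      p = hmul (p.1, 0) (hmul (hmul (a, 0) (b, 0)) (hmul (-a, 0) (-b, 0))) := by
  obtain ⟨h1, h2⟩ := hp
  rw [mem_closedBall_zero_iff] at h1 h2
  let i : Fin n := ⟨0, hn⟩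
  have hs : √|p.2| ≤ r := by
    rw [Real.sqrt_le_left hr]; exact h2
  let a : Fin n → ℂ := Pi.single i ((√|p.2| / 2 : ℝ) * Complex.I)
  let b : Fin n → ℂ := Pi.single i ((SignType.sign p.2 : ℝ) * (√|p.2| / 2 : ℝ) : ℂ)
  have hab : 4 * sympl a b = p.2 := by
    have : sympl a b = (√|p.2| / 2) * ((SignType.sign p.2 : ℝ) * (√|p.2| / 2)) := by
      rw [sympl, Finset.sum_eq_single i]
      · simp [a, b]
      · intro k _ hk; simp [a, b, Pi.single_eq_of_ne hk]
      · simp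
    rw [this]
    have h3 : √|p.2| * √|p.2| = |p.2| := Real.mul_self_sqrt (abs_nonneg _)
    calc _ = (SignType.sign p.2 : ℝ) * (√|p.2| * √|p.2|) := by ring
      _ = p.2 := by rw [h3]; exact sign_mul_abs p.2
  refine ⟨a, b, ?_, ?_, h1, ?_⟩
  · have : ‖a‖ = √|p.2| / 2 := by
      rw [Pi.norm_single]; simp [abs_of_nonneg (Real.sqrt_nonneg _)]
    rw [this]; linarith [Real.sqrt_nonneg |p.2|]
  · have : ‖b‖ ≤ 1 * (√|p.2| / 2) := by
      rw [Pi.norm_single, norm_mul]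
      gcongr
      · rcases lt_trichotomy p.2 0 with h | h | h <;> simp [h]
      · simp [abs_of_nonneg (Real.sqrt_nonneg _)]
    linarith [Real.sqrt_nonneg |p.2|]
  · refine Prod.ext ?_ ?_
    · simp only [hmul]; abel
    · simp only [hmul, sympl_add_left, sympl_add_right, sympl_neg_left, sympl_neg_right, sympl_self]
      rw [sympl_comm b a]
      linarith

theorem diffNorm_le_of_mem_box (hn : 1 ≤ n) {f : Heis n → ℝ} (hf : ContDiff ℝ 1 f) {r : ℝ}
    (hr : 0 ≤ r) {p : Heis n} (hp : p ∈ box n r) :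
    diffNorm f p ≤ ENNReal.ofReal (5 * r) * (∫⁻ x, hgrad f x ^ 2) ^ (1 / 2 : ℝ) := by
  obtain ⟨a, b, ha, hb, hp1, hfac⟩ := exists_horizontal_factorization hn hr hp
  set E := (∫⁻ x, hgrad f x ^ 2) ^ (1 / 2 : ℝ)
  have hw : ∀ w : Fin n → ℂ, ‖w‖ ≤ r → diffNorm f (w, 0) ≤ ENNReal.ofReal r * E := by
    intro w hw
    refine (diffNorm_horizontal_le hf w).trans ?_
    gcongr
    rw [← ofReal_norm]
    exact ENNReal.ofReal_le_ofReal hw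
  have hc := hf.continuous
  rw [hfac]
  calc _ ≤ diffNorm f (p.1, 0) + ((diffNorm f (a, 0) + diffNorm f (b, 0)) +
        (diffNorm f (-a, 0) + diffNorm f (-b, 0))) :=
        (diffNorm_hmul_le hc _ _).trans (add_le_add le_rfl ((diffNorm_hmul_le hc _ _).trans
          (add_le_add (diffNorm_hmul_le hc _ _) (diffNorm_hmul_le hc _ _))))
    _ ≤ ENNReal.ofReal r * E + ((ENNReal.ofReal r * E + ENNReal.ofReal r * E) +
        (ENNReal.ofReal r * E + ENNReal.ofReal r * E)) := by
        gcongr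
        · exact hw _ hp1
        · exact hw _ ha
        · exact hw _ hb
        · exact hw _ (by rwa [norm_neg])
        · exact hw _ (by rwa [norm_neg])
    _ = _ := by
        rw [ENNReal.ofReal_mul (by norm_num)]
        simp only [ENNReal.ofReal_ofNat]
        ring

/-! ### The critical exponent and the weak-type estimate -/

/-- The critical Sobolev exponent `2Q/(Q-2)`. -/
noncomputable def sobExp (n : ℕ) : ℝ := 2 * (homDim n : ℝ) / ((homDim n : ℝ) - 2)

theorem four_le_homDim (hn : 1 ≤ n) : (4 : ℝ) ≤ homDim n := by
  have : (1 : ℝ) ≤ n := by exact_mod_cast hn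
  simp only [homDim]; push_cast; linarith

theorem sobExp_pos (hn : 1 ≤ n) : 0 < sobExp n := by
  have := four_le_homDim hn
  exact div_pos (by linarith) (by linarith)

theorem two_div_sobExp (hn : 1 ≤ n) : 2 / sobExp n = 1 - 2 / (homDim n : ℝ) := by
  have := four_le_homDim hn
  have h1 : (homDim n : ℝ) ≠ 0 := by linarith
  have h2 : (homDim n : ℝ) - 2 ≠ 0 := by linarith
  rw [sobExp]; field_simp

theorem sobExp_sub_two (hn : 1 ≤ n) : sobExp n - 2 = sobExp n * (2 / (homDim n : ℝ)) := by
  have := four_le_homDim hn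
  have h1 : (homDim n : ℝ) ≠ 0 := by linarith
  have h2 : (homDim n : ℝ) - 2 ≠ 0 := by linarith
  rw [sobExp]; field_simp; ring

/-- Take a box of volume `2V`. From any `x` with `|h x| ≥ l`, at least half of the increments `p` in
the box lead outside the support, where the squared difference is at least `l²`. Integrating over
`x` and `p` compares this with the `L²` bound for differences, and `r²` is proportional to
`V^{2/Q}`. -/
theorem volume_level_le (hn : 1 ≤ n) :
    ∃ C : ℝ, 0 < C ∧ ∀ h : Heis n → ℝ, ContDiff ℝ 1 h → ∀ V : ℝ, 0 < V →
      volume {x | h x ≠ 0} ≤ ENNReal.ofReal V → ∀ l : ℝ, 0 < l →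
      ENNReal.ofReal (l ^ 2) * volume {x | l ≤ |h x|} ≤
        ENNReal.ofReal (C * V ^ (2 / (homDim n : ℝ))) * ∫⁻ x, hgrad h x ^ 2 := by
  obtain ⟨c, hc, hbox⟩ := volume_box n
  have hQ := four_le_homDim hn
  refine ⟨50 * (2 / c) ^ (2 / (homDim n : ℝ)), by positivity, fun h hh V hV hS l hl => ?_⟩
  -- The radius for which the box has volume exactly `2V`. The constant `50` is `2 · 5²`: two
  -- volumes `V` and five horizontal steps.
  set r : ℝ := (2 * V / c) ^ (1 / (homDim n : ℝ)) with hr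
  have hr0 : 0 ≤ r := by positivity
  have hrQ : c * r ^ homDim n = 2 * V := by
    rw [hr, ← Real.rpow_natCast, ← Real.rpow_mul (by positivity), one_div,
      inv_mul_cancel₀ (by positivity), Real.rpow_one]
    field_simp
  have hr2 : r ^ 2 = (2 / c) ^ (2 / (homDim n : ℝ)) * V ^ (2 / (homDim n : ℝ)) := by
    rw [hr, ← Real.rpow_natCast, ← Real.rpow_mul (by positivity), ← Real.mul_rpow (by positivity)
      hV.le]
    congr 1
    · ring
    · push_cast; ring
  have hvol : volume (box n r) = ENNReal.ofReal V + ENNReal.ofReal V := by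
    rw [hbox r hr0, hrQ, two_mul, ENNReal.ofReal_add hV.le hV.le]
  have hcont := hh.continuous
  have hpair : Measurable fun a : Heis n × Heis n => ‖h (hmul a.1 a.2) - h a.1‖ₑ ^ 2 :=
    ((hcont.comp continuous_hmul).sub (hcont.comp continuous_fst)).enorm.measurable.pow_const 2
  have hA : MeasurableSet {x | l ≤ |h x|} := (isClosed_le continuous_const hcont.abs).measurableSet
  have hlow : ∀ x ∈ {x | l ≤ |h x|}, ENNReal.ofReal (l ^ 2) * ENNReal.ofReal V ≤
      ∫⁻ p in box n r, ‖h (hmul x p) - h x‖ₑ ^ 2 := by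
    intro x hx
    set Z : Set (Heis n) := {p | h (hmul x p) ≠ 0} with hZ
    have hxc : Continuous fun p => h (hmul x p) := hcont.comp (continuous_const.hmul continuous_id)
    have hZm : MeasurableSet Z := (isOpen_ne_fun hxc continuous_const).measurableSet
    have hZv : volume Z ≤ ENNReal.ofReal V := by
      refine le_trans (le_of_eq ?_) hS
      exact (measurePreserving_hmul_left x).measure_preimage_emb
        (measurableEmbedding_hmul_left x) {x | h x ≠ 0}
    have hdiff : ENNReal.ofReal V ≤ volume (box n r \ Z) := by
      have h1 : ENNReal.ofReal V + ENNReal.ofReal V ≤ volume (box n r \ Z) + ENNReal.ofReal V := by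
        rw [← hvol]
        calc volume (box n r) ≤ volume (box n r \ Z) + volume Z := by
              rw [← measure_sdiff_add_inter (box n r) hZm]
              gcongr
              exact inter_subset_right
          _ ≤ _ := by gcongr
      exact (ENNReal.add_le_add_iff_right ENNReal.ofReal_ne_top).1 h1
    calc ENNReal.ofReal (l ^ 2) * ENNReal.ofReal V
        ≤ ENNReal.ofReal (l ^ 2) * volume (box n r \ Z) := by gcongr
      _ = ∫⁻ p in box n r \ Z, ENNReal.ofReal (l ^ 2) := by simp
      _ ≤ ∫⁻ p in box n r \ Z, ‖h (hmul x p) - h x‖ₑ ^ 2 := by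
          refine setLIntegral_mono' ((measurableSet_box r).diff hZm) fun p hp => ?_
          have hp0 : h (hmul x p) = 0 := by simpa [hZ] using hp.2
          rw [hp0, zero_sub, enorm_neg, ← ofReal_norm, ← ENNReal.ofReal_pow (norm_nonneg _)]
          exact ENNReal.ofReal_le_ofReal (by gcongr; exact hx)
      _ ≤ _ := lintegral_mono_set sdiff_subset
  have hmain : ENNReal.ofReal (l ^ 2) * ENNReal.ofReal V * volume {x | l ≤ |h x|} ≤
      (ENNReal.ofReal V + ENNReal.ofReal V) * (ENNReal.ofReal (25 * r ^ 2) *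
        ∫⁻ x, hgrad h x ^ 2) := by
    calc _ = ∫⁻ x in {x | l ≤ |h x|}, ENNReal.ofReal (l ^ 2) * ENNReal.ofReal V := by simp
      _ ≤ ∫⁻ x in {x | l ≤ |h x|}, ∫⁻ p in box n r, ‖h (hmul x p) - h x‖ₑ ^ 2 :=
          setLIntegral_mono' hA hlow
      _ ≤ ∫⁻ x, ∫⁻ p in box n r, ‖h (hmul x p) - h x‖ₑ ^ 2 := setLIntegral_le_lintegral _ _
      _ = ∫⁻ p in box n r, ∫⁻ x, ‖h (hmul x p) - h x‖ₑ ^ 2 :=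
          lintegral_lintegral_swap hpair.aemeasurable
      _ ≤ ∫⁻ p in box n r, ENNReal.ofReal (25 * r ^ 2) * ∫⁻ x, hgrad h x ^ 2 := by
          refine setLIntegral_mono' (measurableSet_box r) fun p hp => ?_
          rw [← sq_eLpNorm_two]
          refine (pow_le_pow_left' (diffNorm_le_of_mem_box hn hh hr0 hp) 2).trans (le_of_eq ?_)
          rw [mul_pow, ← ENNReal.ofReal_pow (by positivity), ← ENNReal.rpow_natCast
            ((∫⁻ x, hgrad h x ^ 2) ^ (1 / 2 : ℝ)), ← ENNReal.rpow_mul, mul_pow]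
          norm_num
      _ = _ := by rw [setLIntegral_const, hvol, mul_comm]
  have hV0 : ENNReal.ofReal V ≠ 0 := by simpa using hV
  have h2 : ENNReal.ofReal V * (ENNReal.ofReal (l ^ 2) * volume {x | l ≤ |h x|}) ≤
      ENNReal.ofReal V * (ENNReal.ofReal (50 * r ^ 2) * ∫⁻ x, hgrad h x ^ 2) := by
    refine le_trans (le_of_eq (by ring)) (hmain.trans (le_of_eq ?_))
    rw [show (50 * r ^ 2 : ℝ) = 2 * (25 * r ^ 2) by ring,
      ENNReal.ofReal_mul (p := 2) (by norm_num), ENNReal.ofReal_ofNat]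
    ring
  rw [ENNReal.mul_le_mul_iff_right hV0 ENNReal.ofReal_ne_top] at h2
  refine h2.trans (le_of_eq ?_)
  rw [hr2, mul_assoc]

/-! ### Smooth truncation and the strong inequality for `C¹` functions -/

/-- A smooth bump equal to `1` on `[-1, 1]` and supported in `[-2, 2]`. -/
noncomputable def levelBump : ContDiffBump (0 : ℝ) := ⟨1, 2, one_pos, one_lt_two⟩

/-- The smooth truncation of `s` at the level `l`. -/
noncomputable def trunc (l s : ℝ) : ℝ := l * (1 - levelBump (l⁻¹ * s))

theorem contDiff_trunc (l : ℝ) {k : ℕ∞} : ContDiff ℝ k (trunc l) :=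
  contDiff_const.mul (contDiff_const.sub
    ((levelBump.contDiff (n := k)).comp (contDiff_const.mul contDiff_id)))

theorem trunc_eq_zero {l s : ℝ} (hl : 0 < l) (hs : |s| ≤ l) : trunc l s = 0 := by
  have : levelBump (l⁻¹ * s) = 1 := levelBump.one_of_mem_closedBall (by
    rw [mem_closedBall_zero_iff, Real.norm_eq_abs, abs_mul, abs_of_pos (inv_pos.2 hl)]
    rw [inv_mul_le_iff₀ hl]; simpa [levelBump] using hs)
  simp [trunc, this]

theorem trunc_eq_of_le {l s : ℝ} (hl : 0 < l) (hs : 2 * l ≤ |s|) : trunc l s = l := by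
  have : levelBump (l⁻¹ * s) = 0 := levelBump.zero_of_le_dist (by
    rw [dist_zero_right, Real.norm_eq_abs, abs_mul, abs_of_pos (inv_pos.2 hl)]
    rw [le_inv_mul_iff₀ hl]; simpa [levelBump, mul_comm] using hs)
  simp [trunc, this]

theorem trunc_nonneg {l : ℝ} (hl : 0 < l) (s : ℝ) : 0 ≤ trunc l s :=
  mul_nonneg hl.le (sub_nonneg.2 levelBump.le_one)

theorem trunc_le {l : ℝ} (hl : 0 < l) (s : ℝ) : trunc l s ≤ l :=
  mul_le_of_le_one_right hl.le (sub_le_self _ levelBump.nonneg)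

/-- Outside the transition layer the truncation attains its global minimum `0` or its global maximum
`l`. Hence gradients of truncations at dyadic levels live on disjoint sets. -/
theorem deriv_trunc_eq_zero {l s : ℝ} (hl : 0 < l) (hs : |s| ∉ Ioc l (2 * l)) :
    deriv (trunc l) s = 0 := by
  rw [mem_Ioc, not_and_or, not_lt, not_le] at hs
  rcases hs with hs | hs
  · refine IsLocalMin.deriv_eq_zero (Eventually.of_forall fun t => ?_)
    rw [trunc_eq_zero hl hs]; exact trunc_nonneg hl t
  · refine IsLocalMax.deriv_eq_zero (Eventually.of_forall fun t => ?_)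
    rw [trunc_eq_of_le hl hs.le]; exact trunc_le hl t

/-- The factor `l` in front cancels the `l⁻¹` of the inner scaling, so the bound for the fixed bump
serves all levels. -/
theorem exists_deriv_trunc_bound :
    ∃ B : ℝ, 0 < B ∧ ∀ l : ℝ, 0 < l → ∀ s, |deriv (trunc l) s| ≤ B := by
  have hd : ContDiff ℝ 1 levelBump := levelBump.contDiff
  obtain ⟨B, hB⟩ := (levelBump.hasCompactSupport.deriv).exists_bound_of_continuous
    (hd.continuous_deriv le_rfl)
  refine ⟨max B 1, by positivity, fun l hl s => ?_⟩
  have h1 : HasDerivAt (trunc l) (l * (0 - deriv levelBump (l⁻¹ * s) * (l⁻¹ * 1))) s := by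
    refine ((hasDerivAt_const _ _).sub ?_).const_mul l
    exact ((hd.differentiable one_ne_zero _).hasDerivAt).comp s ((hasDerivAt_id s).const_mul l⁻¹)
  rw [h1.deriv]
  have : l * (0 - deriv levelBump (l⁻¹ * s) * (l⁻¹ * 1)) = -deriv levelBump (l⁻¹ * s) := by
    field_simp; ring
  rw [this, abs_neg]
  exact (hB _).trans (le_max_left _ _)

theorem hgrad_trunc {f : Heis n → ℝ} (hf : ContDiff ℝ 1 f) (l : ℝ) (x : Heis n) :
    hgrad (fun y => trunc l (f y)) x = ‖deriv (trunc l) (f x)‖ₑ * hgrad f x := by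
  have h1 : HasFDerivAt (fun y => trunc l (f y)) (deriv (trunc l) (f x) • fderiv ℝ f x) x :=
    HasDerivAt.comp_hasFDerivAt (h₂ := trunc l) x
      (((contDiff_trunc l (k := 1)).differentiable one_ne_zero _).hasDerivAt)
      ((hf.differentiable one_ne_zero x).hasFDerivAt)
  simp only [hgrad, frameDeriv, h1.fderiv, Finset.mul_sum]
  refine Finset.sum_congr rfl fun j _ => ?_
  simp [enorm_mul]

/-- The Folland–Stein inequality for `C¹` functions of compact support. -/
theorem sobolev_contDiff (hn : 1 ≤ n) :
    ∃ C : ℝ, 0 < C ∧ ∀ f : Heis n → ℝ, ContDiff ℝ 1 f → HasCompactSupport f →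
      (∫⁻ x, ‖f x‖ₑ ^ sobExp n) ^ (2 / sobExp n) ≤ ENNReal.ofReal C * ∫⁻ x, hgrad f x ^ 2 := by
  obtain ⟨C, hC, hlevel⟩ := volume_level_le hn
  obtain ⟨B, hB, hderiv⟩ := exists_deriv_trunc_bound
  have hq := sobExp_pos hn
  have hQ := four_le_homDim hn
  set q := sobExp n with hqdef
  set θ : ℝ := 2 / (homDim n : ℝ) with hθ
  have hθ0 : 0 < θ := by positivity
  refine ⟨4 ^ q * C * B ^ 2, by positivity, fun f hf hfc => ?_⟩
  set M := ∫⁻ x, ‖f x‖ₑ ^ q with hM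
  have hcont := hf.continuous
  -- Finiteness is needed because the argument ends by cancelling a power of `M`.
  have hMtop : M ≠ ⊤ := by
    have h1 : MemLp f (ENNReal.ofReal q) volume := hcont.memLp_of_hasCompactSupport hfc
    have := lintegral_rpow_enorm_lt_top_of_eLpNorm_lt_top (by simpa using hq) ENNReal.ofReal_ne_top
      h1.2
    rw [ENNReal.toReal_ofReal hq.le] at this
    exact this.ne
  by_cases hM0 : M = 0
  · rw [hM0, ENNReal.zero_rpow_of_pos (by positivity)]; exact zero_le
  set m := M.toReal with hm
  have hmpos : 0 < m := ENNReal.toReal_pos hM0 hMtop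
  have hMm : M = ENNReal.ofReal m := (ENNReal.ofReal_toReal hMtop).symm
  let S : ℤ → Set (Heis n) := fun k => {x | |f x| ∈ Ioc ((2 : ℝ) ^ k) (2 ^ (k + 1))}
  have hSm : ∀ k, MeasurableSet (S k) := fun k => hcont.abs.measurable measurableSet_Ioc
  have hSd : Pairwise (Function.onFun Disjoint S) := by
    intro i j hij
    have hmono : Monotone fun k : ℤ => (2 : ℝ) ^ k := zpow_right_mono₀ one_le_two
    exact (hmono.pairwise_disjoint_on_Ioc_succ hij).preimage fun x => |f x|
  have hk : ∀ k : ℤ, ENNReal.ofReal ((4 * (2 : ℝ) ^ k) ^ q) * volume {x | 2 * (2 : ℝ) ^ k ≤ |f x|} ≤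
      ENNReal.ofReal (4 ^ q * C * B ^ 2 * m ^ θ) * ∫⁻ x in S k, hgrad f x ^ 2 := by
    intro k
    set l : ℝ := (2 : ℝ) ^ k with hl
    have hl0 : 0 < l := by positivity
    -- Chebyshev's inequality for `|f|^q`; this supplies the volume `V` in the weak-type estimate.
    have hsupp : volume {x | trunc l (f x) ≠ 0} ≤ ENNReal.ofReal (l ^ (-q) * m) := by
      have h1 : {x | trunc l (f x) ≠ 0} ⊆ {x | ENNReal.ofReal (l ^ q) ≤ ‖f x‖ₑ ^ q} := by
        intro x hx
        have hx' : l ≤ |f x| := by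
          by_contra hcon
          exact hx (trunc_eq_zero hl0 (not_le.1 hcon).le)
        rw [mem_ofPred_eq, ← ofReal_norm, ENNReal.ofReal_rpow_of_nonneg (norm_nonneg _) hq.le]
        exact ENNReal.ofReal_le_ofReal (Real.rpow_le_rpow hl0.le hx' hq.le)
      have h2 := mul_meas_ge_le_lintegral (μ := volume) (f := fun x => ‖f x‖ₑ ^ q)
        (hcont.enorm.measurable.pow_const q) (ENNReal.ofReal (l ^ q))
      have h3 : ENNReal.ofReal (l ^ q) * volume {x | trunc l (f x) ≠ 0} ≤
          ENNReal.ofReal (l ^ q) * ENNReal.ofReal (l ^ (-q) * m) := by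
        refine ((mul_le_mul_right (measure_mono h1) _).trans h2).trans (le_of_eq ?_)
        rw [← hM, hMm, ← ENNReal.ofReal_mul (by positivity), ← mul_assoc, ← Real.rpow_add hl0]
        simp
      rwa [ENNReal.mul_le_mul_iff_right (by simp; positivity) ENNReal.ofReal_ne_top] at h3
    have h := hlevel (fun y => trunc l (f y)) ((contDiff_trunc l (k := 1)).comp hf) _
      (by positivity) hsupp l hl0
    have h4 : volume {x | 2 * l ≤ |f x|} ≤ volume {x | l ≤ |trunc l (f x)|} := by
      refine measure_mono fun x hx => ?_
      rw [mem_ofPred_eq, trunc_eq_of_le hl0 hx, abs_of_pos hl0]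
    have h5 : ∫⁻ x, hgrad (fun y => trunc l (f y)) x ^ 2 ≤
        ENNReal.ofReal (B ^ 2) * ∫⁻ x in S k, hgrad f x ^ 2 := by
      rw [← lintegral_const_mul' _ _ ENNReal.ofReal_ne_top, ← lintegral_indicator (hSm k)]
      refine lintegral_mono fun x => ?_
      dsimp only
      rw [hgrad_trunc hf]
      by_cases hx : x ∈ S k
      · rw [indicator_of_mem hx, mul_pow, ENNReal.ofReal_pow hB.le]
        gcongr
        rw [← ofReal_norm]
        exact ENNReal.ofReal_le_ofReal (hderiv l hl0 _)
      · rw [indicator_of_notMem hx, deriv_trunc_eq_zero hl0]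
        · simp
        · intro hx'
          refine hx ?_
          change _ ∈ Ioc _ _
          rwa [zpow_add_one₀ two_ne_zero, mul_comm ((2 : ℝ) ^ k)]
    calc _ = ENNReal.ofReal (4 ^ q * l ^ (q - 2)) *
          (ENNReal.ofReal (l ^ 2) * volume {x | 2 * l ≤ |f x|}) := by
          rw [← mul_assoc, ← ENNReal.ofReal_mul (by positivity), Real.mul_rpow (by norm_num) hl0.le,
            mul_assoc (4 ^ q), ← Real.rpow_natCast l 2, ← Real.rpow_add hl0]
          norm_num
      _ ≤ ENNReal.ofReal (4 ^ q * l ^ (q - 2)) *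
          (ENNReal.ofReal (C * (l ^ (-q) * m) ^ θ) *
            (ENNReal.ofReal (B ^ 2) * ∫⁻ x in S k, hgrad f x ^ 2)) := by
          refine mul_le_mul_right ?_ _
          exact (mul_le_mul_right h4 _).trans (h.trans (mul_le_mul_right h5 _))
      _ = _ := by
          rw [← mul_assoc, ← mul_assoc, ← ENNReal.ofReal_mul (by positivity),
            ← ENNReal.ofReal_mul (by positivity)]
          congr 2
          rw [Real.mul_rpow (by positivity) hmpos.le, ← Real.rpow_mul hl0.le]
          -- The exponent is critical: `q - 2 = qθ`, so the bound carries no power of the level and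
          -- the dyadic terms can be summed.
          have h6 : l ^ (q - 2) * l ^ (-q * θ) = 1 := by
            rw [← Real.rpow_add hl0, sobExp_sub_two hn]
            simp [← hqdef, ← hθ]
          calc _ = (l ^ (q - 2) * l ^ (-q * θ)) * (4 ^ q * C * B ^ 2 * m ^ θ) := by ring
            _ = _ := by rw [h6, one_mul]
  have hsum : M ≤ ∑' k : ℤ, ENNReal.ofReal ((4 * (2 : ℝ) ^ k) ^ q) *
      volume {x | 2 * (2 : ℝ) ^ k ≤ |f x|} := by
    have hm' : ∀ k : ℤ, MeasurableSet {x | 2 * (2 : ℝ) ^ k ≤ |f x|} := fun k =>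
      (isClosed_le continuous_const hcont.abs).measurableSet
    have h1 : ∀ k : ℤ, ENNReal.ofReal ((4 * (2 : ℝ) ^ k) ^ q) *
        volume {x | 2 * (2 : ℝ) ^ k ≤ |f x|} = ∫⁻ x, {x | 2 * (2 : ℝ) ^ k ≤ |f x|}.indicator
          (fun _ => ENNReal.ofReal ((4 * (2 : ℝ) ^ k) ^ q)) x := fun k => by
      rw [lintegral_indicator_const (hm' k)]
    simp_rw [h1]
    rw [← lintegral_tsum fun k => (measurable_const.indicator (hm' k)).aemeasurable]
    refine lintegral_mono fun x => ?_
    dsimp only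
    by_cases hx : f x = 0
    · simp [hx, hq]
    · obtain ⟨k, hk1, hk2⟩ := exists_mem_Ico_zpow (abs_pos.2 hx) (one_lt_two (α := ℝ))
      -- If `2^k ≤ |f x| < 2^(k+1)`, the term of index `k - 1` alone suffices: its threshold is
      -- `2^k` and its weight is `(2^(k+1))^q`.
      refine le_trans ?_ (ENNReal.le_tsum (k - 1))
      have e1 : (2 : ℝ) ^ k = 2 * 2 ^ (k - 1) := by
        rw [← zpow_one_add₀ two_ne_zero]; congr 1; ring
      rw [zpow_add_one₀ two_ne_zero, e1] at hk2
      rw [e1] at hk1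
      rw [indicator_of_mem (by exact hk1), ← ofReal_norm,
        ENNReal.ofReal_rpow_of_nonneg (norm_nonneg _) hq.le]
      refine ENNReal.ofReal_le_ofReal (Real.rpow_le_rpow (norm_nonneg _) ?_ hq.le)
      rw [Real.norm_eq_abs]; linarith
  have hfin : M ≤ ENNReal.ofReal (4 ^ q * C * B ^ 2 * m ^ θ) * ∫⁻ x, hgrad f x ^ 2 := by
    refine hsum.trans ((ENNReal.tsum_le_tsum hk).trans ?_)
    rw [ENNReal.tsum_mul_left, ← lintegral_iUnion hSm hSd]
    exact mul_le_mul_right (setLIntegral_le_lintegral _ _) _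
  -- Since `1 - θ = 2/q`, cancelling `m ^ θ` leaves the desired power of `M`.
  have h7 : ENNReal.ofReal (m ^ θ) * M ^ (2 / q) ≤
      ENNReal.ofReal (m ^ θ) * (ENNReal.ofReal (4 ^ q * C * B ^ 2) * ∫⁻ x, hgrad f x ^ 2) := by
    refine le_trans (le_of_eq ?_) (hfin.trans (le_of_eq ?_))
    · rw [hMm, ENNReal.ofReal_rpow_of_pos hmpos, ← ENNReal.ofReal_mul (by positivity),
        ← Real.rpow_add hmpos, two_div_sobExp hn]
      simp [← hθ]
    · rw [← mul_assoc, ← ENNReal.ofReal_mul (by positivity)]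
      congr 2; ring
  rwa [ENNReal.mul_le_mul_iff_right (by simp; positivity) ENNReal.ofReal_ne_top] at h7

/-! ### Group convolution -/

instance : (volume : Measure (Heis n)).IsAddHaarMeasure :=
  Measure.prod.instIsAddHaarMeasure volume volume

instance : (volume : Measure (Heis n)).IsNegInvariant :=
  Measure.IsAddHaarMeasure.isNegInvariant_of_regular volume

/-- The group convolution `∫ k (x y⁻¹) v (y) dy`. -/
noncomputable def hconv (k v : Heis n → ℝ) (x : Heis n) : ℝ := ∫ y, k (hmul x (-y)) * v y

theorem measurePreserving_neg_hmul (x : Heis n) :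
    MeasurePreserving (fun p : Heis n => hmul (-p) x) :=
  (measurePreserving_hmul_right x).comp (Measure.measurePreserving_neg volume)

theorem measurableEmbedding_neg_hmul (x : Heis n) :
    MeasurableEmbedding (fun p : Heis n => hmul (-p) x) :=
  (measurableEmbedding_hmul_right x).comp (Homeomorph.neg (Heis n)).measurableEmbedding

theorem hmul_neg_neg_hmul (x p : Heis n) : hmul x (-hmul (-p) x) = p := by
  rw [neg_hmul, neg_neg, ← hmul_assoc, hmul_neg_self, zero_hmul]

/-- In this form the convolution is an average of left translates of `v`, which explains both the
`L²` bounds and the compatibility with left invariant fields. -/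
theorem hconv_eq (k v : Heis n → ℝ) (x : Heis n) :
    hconv k v x = ∫ p, k p * v (hmul (-p) x) := by
  rw [hconv, ← (measurePreserving_neg_hmul x).integral_comp (measurableEmbedding_neg_hmul x)]
  simp only [hmul_neg_neg_hmul]

theorem hconv_congr_ae {k v w : Heis n → ℝ} (h : v =ᵐ[volume] w) : hconv k v = hconv k w := by
  funext x
  refine integral_congr_ae ?_
  filter_upwards [h] with y hy
  rw [hy]

theorem contDiff_hconv {k v : Heis n → ℝ} (hk : ContDiff ℝ ∞ k) (hkc : HasCompactSupport k)
    (hv : LocallyIntegrable v) : ContDiff ℝ ∞ (hconv k v) := by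
  have key : ∀ R : ℝ, ContDiffOn ℝ ∞ (hconv k v) (Metric.ball 0 R) := by
    intro R
    have hK : IsCompact ((fun a : Heis n × Heis n => hmul (-a.1) a.2) ''
        (Metric.closedBall 0 R ×ˢ tsupport k)) :=
      ((isCompact_closedBall 0 R).prod hkc).image (continuous_fst.neg.hmul continuous_snd)
    -- The group convolution is an additive convolution evaluated at the origin, with kernel `s ↦ k
    -- (x · s)` and `x` as a parameter. For `x` in a bounded ball these kernels are supported in one
    -- compact set.
    have h := contDiffOn_convolution_right_with_param_comp (μ := volume) (n := ⊤)
      (ContinuousLinearMap.mul ℝ ℝ) (s := Metric.ball (0 : Heis n) R) (v := fun _ => (0 : Heis n))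
      contDiffOn_const (f := v) (g := fun x s => k (hmul x s)) Metric.isOpen_ball hK ?_ hv ?_
    · refine h.congr fun x _ => ?_
      simp only [convolution, hconv, ContinuousLinearMap.mul_apply', zero_sub]
      exact integral_congr_ae (Eventually.of_forall fun y => mul_comm _ _)
    · intro x s hx hs
      by_contra hne
      refine hs ⟨(x, hmul x s), ⟨Metric.ball_subset_closedBall hx, subset_tsupport _ hne⟩, ?_⟩
      simp [← hmul_assoc]
    · exact (hk.comp contDiff_hmul).contDiffOn
  rw [contDiff_iff_contDiffAt]
  intro x
  refine (key (‖x‖ + 1)).contDiffAt (Metric.isOpen_ball.mem_nhds ?_)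
  rw [mem_ball_zero_iff]; linarith

theorem hasCompactSupport_hconv {k v : Heis n → ℝ} (hkc : HasCompactSupport k)
    (hvc : HasCompactSupport v) : HasCompactSupport (hconv k v) := by
  refine HasCompactSupport.intro (IsCompact.image (hkc.prod hvc) continuous_hmul) fun x hx => ?_
  refine integral_eq_zero_of_ae (Eventually.of_forall fun y => ?_)
  by_contra hne
  have h1 : k (hmul x (-y)) ≠ 0 := fun h => hne (by simp [h])
  have h2 : v y ≠ 0 := fun h => hne (by simp [h])
  refine hx ⟨(hmul x (-y), y), ⟨subset_tsupport _ h1, subset_tsupport _ h2⟩, ?_⟩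
  simp [hmul_assoc]

/-- The horizontal direction at the origin of a field of the frame. -/
noncomputable def frameDir : Fin n ⊕ Fin n → Fin n → ℂ
  | Sum.inl i => Pi.single i 1
  | Sum.inr i => Pi.single i Complex.I

theorem frame_eq (j : Fin n ⊕ Fin n) (x : Heis n) :
    frame j x = (frameDir j, 2 * sympl x.1 (frameDir j)) := by
  cases j with
  | inl i =>
    simp only [frame, frameDir, sympl]
    rw [Finset.sum_eq_single i]
    · simp
    · intro b _ hb; simp [Pi.single_eq_of_ne hb]
    · simp
  | inr i =>
    simp only [frame, frameDir, sympl]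
    rw [Finset.sum_eq_single i]
    · simp
    · intro b _ hb; simp [Pi.single_eq_of_ne hb]
    · simp

theorem hasDerivAt_frame_line {f : Heis n → ℝ} (hf : Differentiable ℝ f) (j : Fin n ⊕ Fin n)
    (x : Heis n) :
    HasDerivAt (fun s : ℝ => f (hmul x (s • frameDir j, 0))) (frameDeriv j f x) 0 := by
  have h := hasDerivAt_hmul_line hf x (frameDir j) 0
  have h0 : hmul x (((0 : ℝ) • frameDir j, 0) : Heis n) = x := by
    rw [zero_smul]; exact hmul_zero x
  rwa [h0, ← frame_eq] at h

/-- Differentiate under the integral and move the derivative to the variable `y` of `k (x y⁻¹)`.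
This is then a legitimate test function for the weak derivative. -/
theorem frameDeriv_hconv {k v g : Heis n → ℝ} (hk : ContDiff ℝ ∞ k) (hkc : HasCompactSupport k)
    (hv : Integrable v) (hvc : HasCompactSupport v) (j : Fin n ⊕ Fin n)
    (hw : ∀ φ : Heis n → ℝ, ContDiff ℝ ∞ φ → HasCompactSupport φ →
      ∫ p, v p * frameDeriv j φ p = -∫ p, g p * φ p) :
    frameDeriv j (hconv k v) = hconv k g := by
  funext x
  let Φ : ℝ × Heis n → ℝ := fun a => k (hmul (hmul x (a.1 • frameDir j, 0)) (-a.2))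
  have hΦ : ContDiff ℝ ∞ Φ := by
    refine hk.comp (ContDiff.hmul (contDiff_const.hmul ?_) contDiff_snd.neg)
    exact (contDiff_fst.smul contDiff_const).prodMk contDiff_const
  let D : ℝ × Heis n → ℝ := fun a => fderiv ℝ Φ a (1, 0)
  have hD : Continuous D := (hΦ.continuous_fderiv (by simp)).clm_apply continuous_const
  have hder : ∀ s y, HasDerivAt (fun s : ℝ => Φ (s, y)) (D (s, y)) s := by
    intro s y
    have h1 : HasDerivAt (fun s : ℝ => (s, y)) ((1 : ℝ), (0 : Heis n)) s :=
      (hasDerivAt_id s).prodMk (hasDerivAt_const s y)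
    exact ((hΦ.differentiable (by simp)) (s, y)).hasFDerivAt.comp_hasDerivAt s h1
  obtain ⟨B, hB⟩ := ((isCompact_closedBall (0 : ℝ) 1).prod hvc.isCompact).exists_bound_of_continuousOn
    hD.continuousOn
  have hΦs : ∀ s, Continuous fun y => Φ (s, y) := fun s =>
    hΦ.continuous.comp (continuous_const.prodMk continuous_id)
  have hDs : ∀ s, Continuous fun y => D (s, y) := fun s =>
    hD.comp (continuous_const.prodMk continuous_id)
  have hint : HasDerivAt (fun s : ℝ => ∫ y, Φ (s, y) * v y) (∫ y, D (0, y) * v y) 0 := by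
    refine (hasDerivAt_integral_of_dominated_loc_of_deriv_le (Metric.ball_mem_nhds (0 : ℝ) one_pos)
      (bound := fun y => B * ‖v y‖) (F' := fun s y => D (s, y) * v y) ?_ ?_ ?_ ?_ ?_ ?_).2
    · exact Eventually.of_forall fun s =>
        (hΦs s).aestronglyMeasurable.mul hv.aestronglyMeasurable
    · obtain ⟨B', hB'⟩ := hkc.exists_bound_of_continuous hk.continuous
      exact hv.bdd_mul (hΦs 0).aestronglyMeasurable (Eventually.of_forall fun y => hB' _)
    · exact (hDs 0).aestronglyMeasurable.mul hv.aestronglyMeasurable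
    · refine Eventually.of_forall fun y s hs => ?_
      rw [norm_mul]
      by_cases hy : v y = 0
      · simp [hy]
      · gcongr
        exact hB _ ⟨Metric.ball_subset_closedBall hs, subset_tsupport _ hy⟩
    · exact hv.norm.const_mul B
    · exact Eventually.of_forall fun y s _ => (hder s y).mul_const (v y)
  have h1 := hasDerivAt_frame_line
    ((contDiff_hconv hk hkc hv.locallyIntegrable).differentiable (by simp)) j x
  rw [h1.unique hint]
  have hψ : ContDiff ℝ ∞ fun y => k (hmul x (-y)) :=
    hk.comp (contDiff_const.hmul contDiff_id.neg)
  have hψc : HasCompactSupport fun y => k (hmul x (-y)) :=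
    hkc.comp_homeomorph ((Homeomorph.neg (Heis n)).trans (hmulLeft x))
  -- Moving `y` to `y · (s e, 0)` in `k (x y⁻¹)` has the same effect as moving `x` to `x · (-s e,
  -- 0)`, whence the sign that cancels the one in the weak identity.
  have h2 : ∀ y, frameDeriv j (fun y => k (hmul x (-y))) y = -D (0, y) := by
    intro y
    have h3 := hasDerivAt_frame_line (hψ.differentiable (by simp)) j y
    have h4 : (fun s : ℝ => k (hmul x (-hmul y (s • frameDir j, 0)))) = fun s => Φ (-s, y) := by
      funext s
      simp only [Φ, neg_hmul, hmul_assoc, neg_smul]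
      congr 3
      refine Prod.ext ?_ ?_ <;> simp
    rw [h4] at h3
    have h5 : HasDerivAt (fun s : ℝ => Φ (-s, y)) (D (0, y) * -1) 0 := by
      refine HasDerivAt.comp (h₂ := fun s : ℝ => Φ (s, y)) (0 : ℝ) ?_ (hasDerivAt_neg (0 : ℝ))
      rw [neg_zero]
      exact hder 0 y
    rw [h3.unique h5]; ring
  have h6 := hw _ hψ hψc
  simp only [h2, mul_neg, integral_neg, neg_inj] at h6
  rw [hconv]
  simp only [mul_comm _ (v _), mul_comm _ (g _)]
  exact h6

/-- Jensen for the probability measure with density `|k|`, followed by Tonelli. With `H` a translate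
of `g` it gives the `L²` contraction, and with `H` a difference of translates the convergence of
mollifications. -/
theorem lintegral_sq_integral_kernel_le {k : Heis n → ℝ} (hk : Continuous k)
    (hk1 : ∫⁻ p, ‖k p‖ₑ = 1) {H : Heis n → Heis n → ℝ}
    (hH : Measurable (Function.uncurry H)) :
    ∫⁻ x, ‖∫ p, k p * H p x‖ₑ ^ 2 ≤ ∫⁻ p, ‖k p‖ₑ * ∫⁻ x, ‖H p x‖ₑ ^ 2 := by
  have hkm : Measurable fun p => ‖k p‖ₑ := hk.enorm.measurable
  let κ : Measure (Heis n) := volume.withDensity fun p => ‖k p‖ₑ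
  have : IsProbabilityMeasure κ := ⟨by simpa [κ] using hk1⟩
  have hpx : ∀ x, Measurable fun p => ‖H p x‖ₑ := fun x =>
    (hH.comp (measurable_id.prodMk measurable_const)).enorm
  calc _ ≤ ∫⁻ x, ∫⁻ p, ‖H p x‖ₑ ^ 2 ∂κ := by
        refine lintegral_mono fun x => ?_
        refine le_trans ?_ (sq_lintegral_le κ (hpx x).aemeasurable)
        gcongr
        rw [lintegral_withDensity_eq_lintegral_mul _ hkm (hpx x)]
        refine (enorm_integral_le_lintegral_enorm _).trans (le_of_eq ?_)
        simp only [enorm_mul, Pi.mul_apply]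
    _ = ∫⁻ p, (∫⁻ x, ‖H p x‖ₑ ^ 2) ∂κ := by
        refine lintegral_lintegral_swap ?_
        exact ((hH.comp measurable_swap).enorm.pow_const 2).aemeasurable
    _ = _ := by
        rw [lintegral_withDensity_eq_lintegral_mul _ hkm]
        · rfl
        · exact (hH.enorm.pow_const 2).lintegral_prod_right

theorem lintegral_sq_hconv_le {k g : Heis n → ℝ} (hk : Continuous k)
    (hk1 : ∫⁻ p, ‖k p‖ₑ = 1) (hg : AEStronglyMeasurable g) :
    ∫⁻ x, ‖hconv k g x‖ₑ ^ 2 ≤ ∫⁻ x, ‖g x‖ₑ ^ 2 := by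
  have hae := hg.ae_eq_mk
  have hm : Measurable (hg.mk g) := hg.stronglyMeasurable_mk.measurable
  rw [hconv_congr_ae hae, lintegral_congr_ae (g := fun x => ‖hg.mk g x‖ₑ ^ 2)
    (f := fun x => ‖g x‖ₑ ^ 2) (hae.mono fun x hx => by simp only [hx])]
  simp only [hconv_eq]
  refine (lintegral_sq_integral_kernel_le hk hk1 (H := fun p x => hg.mk g (hmul (-p) x))
    (hm.comp (measurable_fst.neg.hmul measurable_snd))).trans (le_of_eq ?_)
  simp only [lintegral_hmul_left fun x => ‖hg.mk g x‖ₑ ^ 2]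
  rw [lintegral_mul_const _ hk.enorm.measurable, hk1, one_mul]

theorem tendsto_eLpNorm_left_translate {v : Heis n → ℝ} (hv : MemLp v 2) :
    Tendsto (fun p : Heis n => eLpNorm (fun x => v (hmul (-p) x) - v x) 2 volume) (𝓝 0) (𝓝 0) := by
  let G : C(Heis n, C(Heis n, Heis n)) :=
    (ContinuousMap.mk (fun a : Heis n × Heis n => hmul (-a.1) a.2)
      (continuous_fst.neg.hmul continuous_snd)).curry
  have hG : ∀ p, MeasurePreserving (G p) := fun p => measurePreserving_hmul_left (-p)
  have h1 : Continuous fun p => Lp.compMeasurePreserving (G p) (hG p) hv.toLp :=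
    continuous_const.compMeasurePreservingLp G.continuous hG (by simp)
  have h2 := (h1.tendsto 0).sub (tendsto_const_nhds (x := hv.toLp))
  have h0 : Lp.compMeasurePreserving (G 0) (hG 0) hv.toLp = hv.toLp := by
    rw [Lp.toLp_compMeasurePreserving]
    refine MemLp.toLp_congr _ _ (Eventually.of_forall fun x => ?_)
    simp [G]
  rw [h0, sub_self] at h2
  have h3 := (continuous_enorm.tendsto (0 : Lp ℝ 2 (volume : Measure (Heis n)))).comp h2
  rw [enorm_zero] at h3
  refine h3.congr fun p => ?_
  have h4 : Lp.compMeasurePreserving (G p) (hG p) hv.toLp - hv.toLp =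
      ((hv.comp_measurePreserving (hG p)).sub hv).toLp := by
    rw [Lp.toLp_compMeasurePreserving, ← MemLp.toLp_sub]
  simp only [Function.comp_apply]
  rw [h4, Lp.enorm_toLp]
  rfl

/-! ### Mollification and the inequality for weak derivatives -/

/-- A bump at the origin whose support shrinks as `m → ∞`. -/
noncomputable def originBump (n m : ℕ) : ContDiffBump (0 : Heis n) :=
  ⟨1 / (m + 1) / 2, 1 / (m + 1), by positivity, half_lt_self (by positivity)⟩

/-- The mollifiers. -/
noncomputable def mollifier (n m : ℕ) : Heis n → ℝ := (originBump n m).normed volume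

theorem contDiff_mollifier (n m : ℕ) : ContDiff ℝ ∞ (mollifier n m) :=
  (originBump n m).contDiff_normed

theorem hasCompactSupport_mollifier (n m : ℕ) : HasCompactSupport (mollifier n m) :=
  (originBump n m).hasCompactSupport_normed

theorem integral_mollifier (n m : ℕ) : ∫ p, mollifier n m p = 1 :=
  (originBump n m).integral_normed

theorem integrable_mollifier (n m : ℕ) : Integrable (mollifier n m) :=
  (originBump n m).integrable_normed

theorem lintegral_mollifier (n m : ℕ) : ∫⁻ p, ‖mollifier n m p‖ₑ = 1 := by
  have h := ofReal_integral_eq_lintegral_ofReal (integrable_mollifier n m)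
    (Eventually.of_forall fun p => (originBump n m).nonneg_normed p)
  rw [integral_mollifier, ENNReal.ofReal_one] at h
  rw [h]
  refine lintegral_congr fun p => ?_
  rw [← ofReal_norm, Real.norm_of_nonneg]
  exact (originBump n m).nonneg_normed p

theorem mollifier_eq_zero {m : ℕ} {p : Heis n} (hp : 1 / ((m : ℝ) + 1) ≤ ‖p‖) :
    mollifier n m p = 0 := by
  by_contra h
  have h1 : p ∈ Function.support ((originBump n m).normed volume) := h
  rw [ContDiffBump.support_normed_eq, mem_ball_zero_iff] at h1
  exact absurd hp (not_le.2 h1)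

theorem tendsto_hconv_mollifier {v : Heis n → ℝ} (hm : Measurable v) (hv : MemLp v 2)
    (hvi : Integrable v) :
    Tendsto (fun m => eLpNorm (hconv (mollifier n m) v - v) 2 volume) atTop (𝓝 0) := by
  rw [ENNReal.tendsto_nhds_zero]
  intro ε hε
  have h1 := (ENNReal.tendsto_nhds_zero.1 (tendsto_eLpNorm_left_translate hv)) ε hε
  obtain ⟨δ, hδ, hball⟩ := Metric.eventually_nhds_iff_ball.1 h1
  obtain ⟨N, hN⟩ := exists_nat_one_div_lt hδ
  filter_upwards [eventually_ge_atTop N] with m hmN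
  have hmδ : 1 / ((m : ℝ) + 1) < δ := lt_of_le_of_lt (by gcongr) hN
  rw [← ENNReal.pow_le_pow_left_iff two_ne_zero, sq_eLpNorm_two]
  have hk := (contDiff_mollifier n m).continuous
  obtain ⟨B, hB⟩ := (hasCompactSupport_mollifier n m).exists_bound_of_continuous hk
  have hsub : ∀ x, (hconv (mollifier n m) v - v) x =
      ∫ p, mollifier n m p * (v (hmul (-p) x) - v x) := by
    intro x
    have hi : Integrable fun p => mollifier n m p * v (hmul (-p) x) :=
      (((measurePreserving_neg_hmul x).integrable_comp_emb
        (measurableEmbedding_neg_hmul x)).2 hvi).bdd_mul hk.aestronglyMeasurable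
        (Eventually.of_forall hB)
    simp only [mul_sub]
    rw [integral_sub hi ((integrable_mollifier n m).mul_const _), integral_mul_const,
      integral_mollifier, one_mul, ← hconv_eq]
    rfl
  simp only [hsub]
  calc _ ≤ ∫⁻ p, ‖mollifier n m p‖ₑ * ∫⁻ x, ‖v (hmul (-p) x) - v x‖ₑ ^ 2 :=
        lintegral_sq_integral_kernel_le hk (lintegral_mollifier n m)
          (H := fun p x => v (hmul (-p) x) - v x)
          ((hm.comp (measurable_fst.neg.hmul measurable_snd)).sub (hm.comp measurable_snd))
    _ ≤ ∫⁻ p, ‖mollifier n m p‖ₑ * ε ^ 2 := by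
        refine lintegral_mono fun p => ?_
        dsimp only
        by_cases hp : 1 / ((m : ℝ) + 1) ≤ ‖p‖
        · simp [mollifier_eq_zero hp]
        · rw [← sq_eLpNorm_two]
          gcongr
          refine hball p ?_
          rw [mem_ball_zero_iff]
          exact (not_le.1 hp).trans hmδ
    _ = ε ^ 2 := by
        rw [lintegral_mul_const _ hk.enorm.measurable, lintegral_mollifier, one_mul]

/-- The Folland–Stein inequality for functions of compact support with weak horizontal derivatives
in `L²`. -/
theorem sobolev_weak (hn : 1 ≤ n) :
    ∃ C : ℝ, 0 < C ∧ ∀ (v : Heis n → ℝ) (g : Fin n ⊕ Fin n → Heis n → ℝ), HasCompactSupport v →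
      MemLp v 2 → (∀ j, AEStronglyMeasurable (g j)) →
      (∀ j, ∀ φ : Heis n → ℝ, ContDiff ℝ ∞ φ → HasCompactSupport φ →
        ∫ p, v p * frameDeriv j φ p = -∫ p, g j p * φ p) →
      (∫⁻ x, ‖v x‖ₑ ^ sobExp n) ^ (2 / sobExp n) ≤
        ENNReal.ofReal C * ∑ j, ∫⁻ x, ‖g j x‖ₑ ^ 2 := by
  obtain ⟨C, hC, hsob⟩ := sobolev_contDiff hn
  have hq := sobExp_pos hn
  have hn0 : (0 : ℝ) < n := by exact_mod_cast hn
  refine ⟨C * (2 * n), by positivity, fun v g hvc hv hg hw => ?_⟩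
  -- A measurable representative is needed for joint measurability of `(p, x) ↦ v (p⁻¹ x)`. Cutting
  -- it off to `tsupport v` keeps the support compact.
  wlog hvm : Measurable v generalizing v
  · have hae : (tsupport v).indicator (hv.1.mk v) =ᵐ[volume] v := by
      filter_upwards [hv.1.ae_eq_mk] with x hx
      by_cases hxs : x ∈ tsupport v
      · rw [indicator_of_mem hxs, hx]
      · rw [indicator_of_notMem hxs, image_eq_zero_of_notMem_tsupport hxs]
    have h := this ((tsupport v).indicator (hv.1.mk v))
      (HasCompactSupport.intro hvc fun x hx => indicator_of_notMem hx _)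
      ((memLp_congr_ae hae).2 hv) ?_
      (hv.1.stronglyMeasurable_mk.measurable.indicator (isClosed_tsupport v).measurableSet)
    · rwa [lintegral_congr_ae (hae.mono fun x hx => by
        rw [hx])] at h
    · intro j φ hφ hφc
      rw [← hw j φ hφ hφc]
      exact integral_congr_ae (hae.mono fun x hx => by simp only [hx])
  set G := ∑ j, ∫⁻ x, ‖g j x‖ₑ ^ 2 with hG
  have hvi : Integrable v := by
    have : IsFiniteMeasure ((volume : Measure (Heis n)).restrict (tsupport v)) :=
      ⟨by simpa using hvc.isCompact.measure_lt_top⟩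
    have h1 : IntegrableOn v (tsupport v) := (hv.restrict _).integrable (by norm_num)
    exact (integrableOn_iff_integrable_of_support_subset (subset_tsupport v)).1 h1
  have hbound : ∀ m, ∫⁻ x, ‖hconv (mollifier n m) v x‖ₑ ^ sobExp n ≤
      (ENNReal.ofReal (C * (2 * n)) * G) ^ (sobExp n / 2) := by
    intro m
    have hk := contDiff_mollifier n m
    have hkc := hasCompactSupport_mollifier n m
    have hc := contDiff_hconv hk hkc hvi.locallyIntegrable
    have h1 := hsob (hconv (mollifier n m) v) (hc.of_le (by simp)) (hasCompactSupport_hconv hkc hvc)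
    have h2 : ∫⁻ x, hgrad (hconv (mollifier n m) v) x ^ 2 ≤ ENNReal.ofReal (2 * n) * G := by
      have h3 : ∀ x, hgrad (hconv (mollifier n m) v) x ^ 2 ≤
          ENNReal.ofReal (2 * n) * ∑ j, ‖hconv (mollifier n m) (g j) x‖ₑ ^ 2 := by
        intro x
        have h4 := ENNReal.rpow_sum_le_const_mul_sum_rpow
          (Finset.univ : Finset (Fin n ⊕ Fin n))
          (fun j => ‖hconv (mollifier n m) (g j) x‖ₑ) (one_le_two (α := ℝ))
        have h5 : hgrad (hconv (mollifier n m) v) x =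
            ∑ j, ‖hconv (mollifier n m) (g j) x‖ₑ := by
          simp only [hgrad, frameDeriv_hconv hk hkc hvi hvc _ (hw _)]
        rw [h5]
        simp only [ENNReal.rpow_two] at h4
        refine h4.trans (le_of_eq ?_)
        congr 1
        norm_num [two_mul, ENNReal.ofReal_add]
      calc _ ≤ ∫⁻ x, ENNReal.ofReal (2 * n) * ∑ j, ‖hconv (mollifier n m) (g j) x‖ₑ ^ 2 :=
            lintegral_mono h3
        _ = ENNReal.ofReal (2 * n) * ∑ j, ∫⁻ x, ‖hconv (mollifier n m) (g j) x‖ₑ ^ 2 := by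
            rw [lintegral_const_mul' _ _ ENNReal.ofReal_ne_top, lintegral_finsetSum]
            intro j _
            have h6 : hconv (mollifier n m) (g j) = frameDeriv j (hconv (mollifier n m) v) :=
              (frameDeriv_hconv hk hkc hvi hvc j (hw j)).symm
            rw [h6]
            exact (continuous_frameDeriv (hc.of_le (by simp)) j).enorm.measurable.pow_const 2
        _ ≤ _ := by
            refine mul_le_mul_right (Finset.sum_le_sum fun j _ => ?_) _
            exact lintegral_sq_hconv_le hk.continuous (lintegral_mollifier n m) (hg j)
    have h3 := h1.trans (mul_le_mul_right h2 _)
    rw [← mul_assoc, ← ENNReal.ofReal_mul hC.le] at h3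
    have h4 := ENNReal.rpow_le_rpow h3 (show 0 ≤ sobExp n / 2 by positivity)
    rwa [← ENNReal.rpow_mul, div_mul_div_cancel₀ hq.ne', div_self two_ne_zero,
      ENNReal.rpow_one] at h4
  have hL2 := tendsto_hconv_mollifier hvm hv hvi
  have hmeas := tendstoInMeasure_of_tendsto_eLpNorm (p := 2) two_ne_zero
    (fun m => (contDiff_hconv (contDiff_mollifier n m) (hasCompactSupport_mollifier n m)
      hvi.locallyIntegrable).continuous.aestronglyMeasurable) hv.1 hL2
  obtain ⟨ns, -, hns⟩ := hmeas.exists_seq_tendsto_ae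
  -- `L²` convergence gives an almost everywhere convergent subsequence, along which Fatou passes
  -- the uniform bound to `v`.
  have hfatou : ∫⁻ x, ‖v x‖ₑ ^ sobExp n ≤
      (ENNReal.ofReal (C * (2 * n)) * G) ^ (sobExp n / 2) := by
    calc _ = ∫⁻ x, liminf (fun i => ‖hconv (mollifier n (ns i)) v x‖ₑ ^ sobExp n) atTop := by
          refine lintegral_congr_ae (hns.mono fun x hx => ?_)
          exact (((ENNReal.continuous_rpow_const (y := sobExp n)).tendsto _).comp
            ((continuous_enorm.tendsto _).comp hx)).liminf_eq.symm
      _ ≤ liminf (fun i => ∫⁻ x, ‖hconv (mollifier n (ns i)) v x‖ₑ ^ sobExp n) atTop :=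
          lintegral_liminf_le fun i => (contDiff_hconv (contDiff_mollifier n (ns i))
            (hasCompactSupport_mollifier n (ns i))
            hvi.locallyIntegrable).continuous.enorm.measurable.pow_const _
      _ ≤ _ := liminf_le_of_le (by isBoundedDefault) fun b hb => by
          obtain ⟨i, hi⟩ := hb.exists
          exact hi.trans (hbound (ns i))
  have h4 := ENNReal.rpow_le_rpow hfatou (show 0 ≤ 2 / sobExp n by positivity)
  rwa [← ENNReal.rpow_mul, div_mul_div_cancel₀ two_ne_zero, div_self hq.ne',
    ENNReal.rpow_one] at h4

/-! ### The homogeneous norm -/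

/-- The Euclidean length `|z|²` of the horizontal part. -/
noncomputable def hsq (p : Heis n) : ℝ := ∑ i, ‖p.1 i‖ ^ 2

/-- The fourth power of the homogeneous norm. -/
noncomputable def gauge (p : Heis n) : ℝ := hsq p ^ 2 + p.2 ^ 2

theorem hsq_nonneg (p : Heis n) : 0 ≤ hsq p := Finset.sum_nonneg fun _ _ => by positivity

theorem gauge_nonneg (p : Heis n) : 0 ≤ gauge p := by unfold gauge; positivity

theorem homNorm_eq (p : Heis n) : homNorm p = gauge p ^ (1 / 4 : ℝ) := rfl

theorem homNorm_nonneg (p : Heis n) : 0 ≤ homNorm p := Real.rpow_nonneg (gauge_nonneg p) _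

theorem homNorm_pow_four (p : Heis n) : homNorm p ^ 4 = gauge p := by
  rw [homNorm_eq, ← Real.rpow_natCast, ← Real.rpow_mul (gauge_nonneg p)]
  norm_num

theorem hsq_le (p : Heis n) : hsq p ≤ homNorm p ^ 2 := by
  refine le_of_sq_le_sq ?_ (by positivity)
  rw [← pow_mul, homNorm_pow_four, gauge]
  nlinarith [sq_nonneg p.2]

theorem abs_snd_le (p : Heis n) : |p.2| ≤ homNorm p ^ 2 := by
  refine le_of_sq_le_sq ?_ (by positivity)
  rw [← pow_mul, homNorm_pow_four, gauge, sq_abs]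
  nlinarith [sq_nonneg (hsq p)]

theorem norm_fst_apply_le (p : Heis n) (i : Fin n) : ‖p.1 i‖ ≤ homNorm p := by
  refine le_of_sq_le_sq ?_ (homNorm_nonneg p)
  refine le_trans ?_ (hsq_le p)
  exact Finset.single_le_sum (f := fun i => ‖p.1 i‖ ^ 2) (fun _ _ => by positivity)
    (Finset.mem_univ i)

theorem homNorm_eq_zero_iff (p : Heis n) : homNorm p = 0 ↔ p = 0 := by
  constructor
  · intro h
    refine Prod.ext ?_ ?_
    · funext i
      have := norm_fst_apply_le p i
      rw [h] at this
      simpa using this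
    · have := abs_snd_le p
      rw [h] at this
      simpa using this
  · rintro rfl
    simp [homNorm]

theorem homNorm_pos {p : Heis n} (hp : p ≠ 0) : 0 < homNorm p :=
  (homNorm_nonneg p).lt_of_ne fun h => hp ((homNorm_eq_zero_iff p).1 h.symm)

theorem contDiff_gauge {k : WithTop ℕ∞} : ContDiff ℝ k (gauge : Heis n → ℝ) := by
  have h : ∀ i, ContDiff ℝ k fun p : Heis n => ‖p.1 i‖ ^ 2 := by
    intro i
    exact ((contDiff_apply ℝ ℂ i).comp contDiff_fst).norm_sq ℝ
  exact ((ContDiff.sum fun i _ => h i).pow 2).add (contDiff_snd.pow 2)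

theorem continuous_homNorm : Continuous (homNorm : Heis n → ℝ) :=
  (contDiff_gauge (k := 0)).continuous.rpow_const fun _ => Or.inr (by norm_num)

theorem homNorm_dilation {r : ℝ} (hr : 0 < r) (p : Heis n) :
    homNorm (dilation r p) = r * homNorm p := by
  have h : gauge (dilation r p) = r ^ 4 * gauge p := by
    simp only [gauge, hsq, dilation, norm_mul, mul_pow, Complex.norm_real, Real.norm_eq_abs,
      sq_abs, ← Finset.mul_sum]
    ring
  rw [homNorm_eq, h, Real.mul_rpow (by positivity) (gauge_nonneg p), ← homNorm_eq,
    ← Real.rpow_natCast, ← Real.rpow_mul hr.le]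
  norm_num

theorem isCompact_shell (a b : ℝ) : IsCompact {p : Heis n | a ≤ homNorm p ∧ homNorm p ≤ b} := by
  refine Metric.isCompact_of_isClosed_isBounded ?_ ?_
  · exact (isClosed_le continuous_const continuous_homNorm).inter
      (isClosed_le continuous_homNorm continuous_const)
  · refine (Metric.isBounded_closedBall (x := (0 : Heis n)) (r := max b (b ^ 2))).subset ?_
    rintro p ⟨-, hp⟩
    have hb : 0 ≤ b := (homNorm_nonneg p).trans hp
    rw [mem_closedBall_zero_iff, Prod.norm_def]
    refine max_le ?_ ?_
    · refine le_max_of_le_left ((pi_norm_le_iff_of_nonneg hb).2 fun i => ?_)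
      exact (norm_fst_apply_le p i).trans hp
    · refine le_max_of_le_right ((abs_snd_le p).trans ?_)
      exact pow_le_pow_left₀ (homNorm_nonneg p) hp 2

/-- Along a frame line the gauge is the polynomial `(|z|² + 2bs + s²)² + (t + 2cs)²`, where `b` and
`c` are, up to sign, the two real coordinates of one `z_i`. Its derivative at zero is `4|z|²b +
4tc`. -/
theorem abs_frameDeriv_gauge_le (j : Fin n ⊕ Fin n) (p : Heis n) :
    |frameDeriv j gauge p| ≤ 8 * homNorm p ^ 3 := by
  obtain ⟨b, c, hb, hc, hline⟩ : ∃ b c : ℝ, |b| ≤ homNorm p ∧ |c| ≤ homNorm p ∧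
      ∀ s : ℝ, gauge (hmul p (s • frameDir j, 0)) =
        (hsq p + 2 * b * s + s ^ 2) ^ 2 + (p.2 + 2 * c * s) ^ 2 := by
    have hsum : ∀ (i : Fin n) (w : ℂ) (s : ℝ), ‖w‖ = 1 →
        hsq (hmul p (s • (Pi.single i w : Fin n → ℂ), 0)) =
          hsq p + 2 * ((p.1 i).re * w.re + (p.1 i).im * w.im) * s + s ^ 2 := by
      intro i w s hw
      have hw2 : w.re ^ 2 + w.im ^ 2 = 1 := by
        have := Complex.sq_norm w
        rw [hw, Complex.normSq_apply] at this
        linarith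
      have h1 : ∀ k, ‖(hmul p (s • (Pi.single i w : Fin n → ℂ), 0)).1 k‖ ^ 2 =
          ‖p.1 k‖ ^ 2 + if k = i then
            2 * ((p.1 i).re * w.re + (p.1 i).im * w.im) * s + s ^ 2 else 0 := by
        intro k
        by_cases hk : k = i
        · subst hk
          simp only [hmul, Pi.add_apply, Pi.smul_apply, Pi.single_eq_same, if_true,
            Complex.sq_norm, Complex.normSq_apply, Complex.add_re, Complex.add_im,
            Complex.smul_re, Complex.smul_im, smul_eq_mul]
          linear_combination s ^ 2 * hw2
        · simp [hmul, hk]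
      rw [hsq, Finset.sum_congr rfl fun k _ => h1 k, Finset.sum_add_distrib,
        Finset.sum_ite_eq' Finset.univ i]
      simp [hsq]
      ring
    have hre : ∀ i, |(p.1 i).re| ≤ homNorm p := fun i =>
      (Complex.abs_re_le_norm _).trans (norm_fst_apply_le p i)
    have him : ∀ i, |(p.1 i).im| ≤ homNorm p := fun i =>
      (Complex.abs_im_le_norm _).trans (norm_fst_apply_le p i)
    cases j with
    | inl i =>
      refine ⟨(p.1 i).re, (p.1 i).im, hre i, him i, fun s => ?_⟩
      have h2 : 2 * sympl p.1 (frameDir (Sum.inl i)) = 2 * (p.1 i).im :=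
        (congrArg Prod.snd (frame_eq (Sum.inl i) p)).symm
      rw [gauge, frameDir, hsum i 1 s (by simp)]
      rw [frameDir] at h2
      simp only [hmul, sympl_smul_right, Complex.one_re, Complex.one_im]
      congr 2
      · ring
      · linear_combination s * h2
    | inr i =>
      refine ⟨(p.1 i).im, -(p.1 i).re, him i, by rw [abs_neg]; exact hre i, fun s => ?_⟩
      have h2 : 2 * sympl p.1 (frameDir (Sum.inr i)) = -2 * (p.1 i).re :=
        (congrArg Prod.snd (frame_eq (Sum.inr i) p)).symm
      rw [gauge, frameDir, hsum i Complex.I s (by simp)]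
      rw [frameDir] at h2
      simp only [hmul, sympl_smul_right, Complex.I_re, Complex.I_im]
      congr 2
      · ring
      · linear_combination s * h2
  have h1 := hasDerivAt_frame_line ((contDiff_gauge (k := 1)).differentiable one_ne_zero) j p
  simp only [hline] at h1
  have h2 : HasDerivAt (fun s : ℝ => (hsq p + 2 * b * s + s ^ 2) ^ 2 + (p.2 + 2 * c * s) ^ 2)
      (4 * hsq p * b + 4 * p.2 * c) 0 := by
    have ha : HasDerivAt (fun s : ℝ => hsq p + 2 * b * s + s ^ 2) (2 * b * 1 + 0) 0 := by
      refine HasDerivAt.congr_deriv ((((hasDerivAt_id (0 : ℝ)).const_mul (2 * b)).const_add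
        (hsq p)).add ((hasDerivAt_id (0 : ℝ)).pow 2)) ?_
      simp
    have hb' : HasDerivAt (fun s : ℝ => p.2 + 2 * c * s) (2 * c * 1) 0 :=
      ((hasDerivAt_id (0 : ℝ)).const_mul (2 * c)).const_add p.2
    refine ((ha.pow 2).add (hb'.pow 2)).congr_deriv ?_
    norm_num
    ring
  rw [h1.unique h2]
  have hN := homNorm_nonneg p
  calc |4 * hsq p * b + 4 * p.2 * c| ≤ 4 * hsq p * |b| + 4 * |p.2| * |c| := by
        refine (abs_add_le _ _).trans (le_of_eq ?_)
        simp [abs_mul, abs_of_nonneg (hsq_nonneg p)]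
    _ ≤ 4 * homNorm p ^ 2 * homNorm p + 4 * homNorm p ^ 2 * homNorm p := by
        have := hsq_le p
        have := abs_snd_le p
        gcongr
    _ = _ := by ring

/-! ### Logarithmic cutoffs -/

/-- The profile of the logarithmic cutoffs: `1` on `[1, 2]`, supported in `[0, 3]`. -/
noncomputable def logBump : ContDiffBump (3 / 2 : ℝ) := ⟨1 / 2, 3 / 2, by norm_num, by norm_num⟩

open Classical in
/-- A cutoff equal to `1` for `e^l ≤ |x| ≤ e^{2l}` and supported in `1 ≤ |x| ≤ e^{3l}`. -/
noncomputable def logCutoff (l : ℝ) (p : Heis n) : ℝ :=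
  if p = 0 then 0 else logBump (Real.log (gauge p) / (4 * l))

theorem log_gauge (p : Heis n) : Real.log (gauge p) = 4 * Real.log (homNorm p) := by
  rw [← homNorm_pow_four, Real.log_pow]; norm_num

theorem logCutoff_of_ne {l : ℝ} {p : Heis n} (hp : p ≠ 0) :
    logCutoff l p = logBump (Real.log (homNorm p) / l) := by
  rw [logCutoff, if_neg hp, log_gauge p, mul_div_mul_left _ _ (by norm_num)]

theorem logCutoff_eq_zero {l : ℝ} (hl : 0 < l) {p : Heis n}
    (hp : homNorm p ≤ 1 ∨ Real.exp (3 * l) ≤ homNorm p) : logCutoff l p = 0 := by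
  by_cases h0 : p = 0
  · rw [logCutoff, if_pos h0]
  rw [logCutoff_of_ne h0]
  refine logBump.zero_of_le_dist ?_
  have hN := homNorm_pos h0
  simp only [logBump, Real.dist_eq]
  rcases hp with hp | hp
  · have : Real.log (homNorm p) / l ≤ 0 :=
      div_nonpos_of_nonpos_of_nonneg (Real.log_nonpos hN.le hp) hl.le
    rw [abs_of_neg (by linarith)]; linarith
  · have : 3 ≤ Real.log (homNorm p) / l := by
      rw [le_div_iff₀ hl, Real.le_log_iff_exp_le hN]; exact hp
    rw [abs_of_pos (by linarith)]; linarith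

theorem logCutoff_eq_one {l : ℝ} (hl : 0 < l) {p : Heis n}
    (hp : Real.exp l ≤ homNorm p) (hp' : homNorm p ≤ Real.exp (2 * l)) : logCutoff l p = 1 := by
  have hN : 0 < homNorm p := (Real.exp_pos l).trans_le hp
  have h0 : p ≠ 0 := fun h => hN.ne' ((homNorm_eq_zero_iff p).2 h)
  rw [logCutoff_of_ne h0]
  refine logBump.one_of_mem_closedBall ?_
  simp only [logBump, Metric.mem_closedBall, Real.dist_eq]
  have h1 : 1 ≤ Real.log (homNorm p) / l := by
    rw [le_div_iff₀ hl, one_mul, Real.le_log_iff_exp_le hN]; exact hp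
  have h2 : Real.log (homNorm p) / l ≤ 2 := by
    rw [div_le_iff₀ hl, Real.log_le_iff_le_exp hN]; exact hp'
  rw [abs_le]; constructor <;> linarith

theorem logCutoff_nonneg (l : ℝ) (p : Heis n) : 0 ≤ logCutoff l p := by
  unfold logCutoff; split_ifs
  · exact le_rfl
  · exact logBump.nonneg

theorem logCutoff_le_one (l : ℝ) (p : Heis n) : logCutoff l p ≤ 1 := by
  unfold logCutoff; split_ifs
  · exact zero_le_one
  · exact logBump.le_one

theorem logCutoff_eventuallyEq {l : ℝ} {p : Heis n} (hp : p ≠ 0) :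
    logCutoff l =ᶠ[𝓝 p] fun x => logBump (Real.log (gauge x) / (4 * l)) := by
  filter_upwards [isOpen_ne.mem_nhds hp] with x hx
  rw [logCutoff, if_neg hx]

theorem gauge_ne_zero {p : Heis n} (hp : p ≠ 0) : gauge p ≠ 0 := by
  rw [← homNorm_pow_four]; exact pow_ne_zero 4 (homNorm_pos hp).ne'

/-- The cutoff vanishes near the origin. Elsewhere it is a smooth function of the logarithm of the
gauge, a polynomial that is positive there. -/
theorem contDiff_logCutoff {l : ℝ} (hl : 0 < l) : ContDiff ℝ ∞ (logCutoff l : Heis n → ℝ) := by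
  rw [contDiff_iff_contDiffAt]
  intro p
  by_cases hp : p = 0
  · have h1 : logCutoff l =ᶠ[𝓝 p] fun _ => (0 : ℝ) := by
      have h2 : ∀ᶠ x in 𝓝 p, homNorm x < 1 := by
        refine continuous_homNorm.tendsto p (Iio_mem_nhds ?_)
        rw [hp, (homNorm_eq_zero_iff 0).2 rfl]; exact one_pos
      filter_upwards [h2] with x hx
      exact logCutoff_eq_zero hl (Or.inl hx.le)
    exact contDiffAt_const.congr_of_eventuallyEq h1
  · refine ContDiffAt.congr_of_eventuallyEq ?_ (logCutoff_eventuallyEq hp)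
    refine (logBump.contDiff (n := ⊤)).contDiffAt.comp p ?_
    exact (contDiff_gauge.contDiffAt.log (gauge_ne_zero hp)).div_const _

theorem tsupport_logCutoff_subset {l : ℝ} (hl : 0 < l) :
    tsupport (logCutoff l : Heis n → ℝ) ⊆ {p | 1 ≤ homNorm p ∧ homNorm p ≤ Real.exp (3 * l)} := by
  refine closure_minimal (fun p hp => ?_) (isCompact_shell _ _).isClosed
  by_contra hcon
  refine hp (logCutoff_eq_zero hl ?_)
  by_contra h
  push Not at h
  exact hcon ⟨h.1.le, h.2.le⟩

theorem hasCompactSupport_logCutoff {l : ℝ} (hl : 0 < l) :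
    HasCompactSupport (logCutoff l : Heis n → ℝ) :=
  (isCompact_shell _ _).of_isClosed_subset (isClosed_tsupport _) (tsupport_logCutoff_subset hl)

theorem frameDeriv_logCutoff_eq_zero {l : ℝ} (hl : 0 < l) (j : Fin n ⊕ Fin n) {p : Heis n}
    (hp : homNorm p < 1 ∨ Real.exp (3 * l) ≤ homNorm p) : frameDeriv j (logCutoff l) p = 0 := by
  have h : IsLocalMin (logCutoff l) p := Eventually.of_forall fun x => by
    rw [logCutoff_eq_zero hl (hp.imp_left le_of_lt)]
    exact logCutoff_nonneg l x
  rw [frameDeriv, h.fderiv_eq_zero, zero_apply]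

/-- By the chain rule the gradient of `log |x|` is `O(1 / |x|)`, and the profile is stretched by
`l`. -/
theorem exists_frameDeriv_logCutoff_bound (n : ℕ) :
    ∃ B : ℝ, 0 < B ∧ ∀ l : ℝ, 0 < l → ∀ (j : Fin n ⊕ Fin n) (p : Heis n), p ≠ 0 →
      |frameDeriv j (logCutoff l) p| ≤ B / (l * homNorm p) := by
  have hd : ContDiff ℝ 1 logBump := logBump.contDiff
  obtain ⟨B, hB⟩ := (logBump.hasCompactSupport.deriv).exists_bound_of_continuous
    (hd.continuous_deriv le_rfl)
  have hB0 : 0 ≤ B := (norm_nonneg _).trans (hB 0)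
  refine ⟨2 * B + 1, by positivity, fun l hl j p hp => ?_⟩
  have hN := homNorm_pos hp
  set a := Real.log (gauge p) / (4 * l) with ha
  have h1 : HasFDerivAt (logCutoff l)
      (deriv logBump a • ((4 * l)⁻¹ • ((gauge p)⁻¹ • fderiv ℝ gauge p))) p := by
    refine HasFDerivAt.congr_of_eventuallyEq ?_ (logCutoff_eventuallyEq hp)
    refine HasDerivAt.comp_hasFDerivAt (h₂ := logBump) p
      (hd.differentiable one_ne_zero _).hasDerivAt ?_
    have h2 := (((contDiff_gauge (k := 1)).differentiable one_ne_zero p).hasFDerivAt.log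
      (gauge_ne_zero hp)).const_mul (4 * l)⁻¹
    refine h2.congr_of_eventuallyEq (Eventually.of_forall fun x => ?_)
    simp only [div_eq_inv_mul]
  have h3 : frameDeriv j (logCutoff l) p =
      deriv logBump a * ((4 * l)⁻¹ * ((homNorm p ^ 4)⁻¹ * frameDeriv j gauge p)) := by
    rw [frameDeriv, h1.fderiv, homNorm_pow_four]; rfl
  rw [h3, abs_mul, abs_mul, abs_mul, abs_of_pos (show 0 < (4 * l)⁻¹ by positivity),
    abs_of_pos (show 0 < (homNorm p ^ 4)⁻¹ by positivity)]
  calc _ ≤ B * ((4 * l)⁻¹ * ((homNorm p ^ 4)⁻¹ * (8 * homNorm p ^ 3))) := by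
        gcongr
        · exact hB a
        · exact abs_frameDeriv_gauge_le j p
    _ = 2 * B / (l * homNorm p) := by field_simp; ring
    _ ≤ _ := by gcongr; linarith

/-! ### The product rule for weak derivatives and cutoffs -/

theorem MemL2loc.integrable_mul {U : Set (Heis n)} (hU : IsOpen U) {f ψ : Heis n → ℝ}
    (hf : MemL2loc U f) (hψ : Continuous ψ) {K : Set (Heis n)} (hK : IsCompact K) (hKU : K ⊆ U)
    (hψK : ∀ p, p ∉ K → ψ p = 0) : Integrable fun p => f p * ψ p := by
  have h1 : IntegrableOn f K := (hf.locallyIntegrableOn hU).integrableOn_compact_subset hKU hK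
  refine (integrableOn_iff_integrable_of_support_subset fun p hp => ?_).1
    (h1.mul_continuousOn hψ.continuousOn hK)
  by_contra hpK
  exact hp (by simp [hψK p hpK])

theorem frameDeriv_mul {f h : Heis n → ℝ} (hf : Differentiable ℝ f) (hh : Differentiable ℝ h)
    (j : Fin n ⊕ Fin n) (p : Heis n) :
    frameDeriv j (fun x => f x * h x) p = f p * frameDeriv j h p + h p * frameDeriv j f p := by
  have h1 : HasFDerivAt (fun x => f x * h x) (f p • fderiv ℝ h p + h p • fderiv ℝ f p) p :=
    (hf p).hasFDerivAt.mul (hh p).hasFDerivAt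
  simp [frameDeriv, h1.fderiv]

theorem frameDeriv_eq_zero_of_notMem_tsupport {f : Heis n → ℝ} (j : Fin n ⊕ Fin n) {p : Heis n}
    (hp : p ∉ tsupport f) : frameDeriv j f p = 0 := by
  have h : p ∉ tsupport (fderiv ℝ f) := fun h' => hp (tsupport_fderiv_subset ℝ h')
  rw [frameDeriv, image_eq_zero_of_notMem_tsupport h, zero_apply]

/-- The Leibniz rule for the product of a weakly differentiable function and a cutoff. -/
theorem IsWeakFrameDeriv.integral_cutoff {U : Set (Heis n)} (hU : IsOpen U) {j : Fin n ⊕ Fin n}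
    {u g η : Heis n → ℝ} (hu : MemL2loc U u) (hg : IsWeakFrameDeriv U j u g)
    (hη : ContDiff ℝ ∞ η) (hηc : HasCompactSupport η) (hηU : tsupport η ⊆ U)
    {φ : Heis n → ℝ} (hφ : ContDiff ℝ ∞ φ) :
    ∫ p, (η p * u p) * frameDeriv j φ p =
      -∫ p, (η p * g p + u p * frameDeriv j η p) * φ p := by
  have hη1 : ContDiff ℝ 1 η := hη.of_le (by simp)
  have hφ1 : ContDiff ℝ 1 φ := hφ.of_le (by simp)
  have hη0 : ∀ p, p ∉ tsupport η → η p = 0 := fun p hp => image_eq_zero_of_notMem_tsupport hp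
  -- Only the product with `η` has to be an admissible test function in `U`; `φ` may be nonzero
  -- outside `U`.
  have h := hg.2 (fun p => η p * φ p) (hη.mul hφ) hηc.mul_right
    ((tsupport_mul_subset_left).trans hηU)
  have i1 : Integrable fun p => u p * (η p * frameDeriv j φ p) :=
    hu.integrable_mul hU (hη.continuous.mul (continuous_frameDeriv hφ1 j)) hηc hηU
      fun p hp => by simp [hη0 p hp]
  have i2 : Integrable fun p => u p * (φ p * frameDeriv j η p) :=
    hu.integrable_mul hU (hφ.continuous.mul (continuous_frameDeriv hη1 j)) hηc hηU
      fun p hp => by simp [frameDeriv_eq_zero_of_notMem_tsupport j hp]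
  have i3 : Integrable fun p => g p * (η p * φ p) :=
    hg.1.integrable_mul hU (hη.continuous.mul hφ.continuous) hηc hηU
      fun p hp => by simp [hη0 p hp]
  simp only [frameDeriv_mul (hη1.differentiable one_ne_zero) (hφ1.differentiable one_ne_zero),
    mul_add] at h
  rw [integral_add i1 i2] at h
  have e1 : ∫ p, (η p * u p) * frameDeriv j φ p = ∫ p, u p * (η p * frameDeriv j φ p) :=
    integral_congr_ae (Eventually.of_forall fun p => by simp only; ring)
  have e2 : ∫ p, (η p * g p + u p * frameDeriv j η p) * φ p =
      ∫ p, (g p * (η p * φ p) + u p * (φ p * frameDeriv j η p)) :=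
    integral_congr_ae (Eventually.of_forall fun p => by simp only; ring)
  rw [e1, e2, integral_add i3 i2]
  linarith

/-! ### Behaviour under dilations -/

/-- Dilations are group automorphisms, so they carry a frame line to the frame line through the
dilated point, with speed multiplied by `r`. -/
theorem frameDeriv_comp_dilation {φ : Heis n → ℝ} (hφ : Differentiable ℝ φ) (r : ℝ)
    (j : Fin n ⊕ Fin n) (p : Heis n) :
    frameDeriv j (fun x => φ (dilation r x)) p = r * frameDeriv j φ (dilation r p) := by
  have h1 := hasDerivAt_frame_line (f := fun x => φ (dilation r x))
    (hφ.comp ((contDiff_dilation (k := 1) r).differentiable one_ne_zero)) j p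
  have h2 : ∀ s : ℝ, dilation r (hmul p (s • frameDir j, 0)) =
      hmul (dilation r p) ((r * s) • frameDir j, 0) := by
    intro s
    simp only [dilation_eq, hmul]
    refine Prod.ext ?_ ?_
    · simp only [smul_add, smul_smul]
    · simp only [smul_eq_mul, sympl_smul_left, sympl_smul_right]; ring
  simp only [h2] at h1
  have h3 := hasDerivAt_frame_line hφ j (dilation r p)
  have h4 : HasDerivAt (fun s : ℝ => φ (hmul (dilation r p) ((r * s) • frameDir j, 0)))
      (frameDeriv j φ (dilation r p) * (r * 1)) 0 := by
    refine HasDerivAt.comp (h₂ := fun s : ℝ => φ (hmul (dilation r p) (s • frameDir j, 0)))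
      (0 : ℝ) ?_ ((hasDerivAt_id (0 : ℝ)).const_mul r)
    simpa using h3
  rw [h1.unique h4]; ring

theorem dilation_ne_zero {r : ℝ} (hr : 0 < r) {p : Heis n} (hp : p ≠ 0) : dilation r p ≠ 0 := by
  have h := homNorm_dilation hr p
  intro h0
  rw [(homNorm_eq_zero_iff _).2 h0] at h
  exact (mul_pos hr (homNorm_pos hp)).ne h

theorem MemL2loc.comp_dilation {g : Heis n → ℝ} (hg : MemL2loc {0}ᶜ g) {r : ℝ} (hr : 0 < r) :
    MemL2loc {0}ᶜ fun p => g (dilation r p) := by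
  intro K hK hKU
  have hemb := measurableEmbedding_dilation (n := n) r hr
  have hK' : IsCompact (dilation r '' K) := hK.image (contDiff_dilation (k := 0) r).continuous
  have h1 : MemLp g 2 (volume.restrict (dilation r '' K)) := by
    refine hg _ hK' ?_
    rintro _ ⟨p, hp, rfl⟩
    exact dilation_ne_zero hr (hKU hp)
  have h2 : Measure.map (dilation r) (volume.restrict K) =
      ENNReal.ofReal (r ^ homDim n)⁻¹ • volume.restrict (dilation r '' K) := by
    rw [← Measure.restrict_smul, ← map_dilation r hr, hemb.restrict_map,
      preimage_image_eq _ hemb.injective]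
  have h3 := h1.smul_measure (c := ENNReal.ofReal (r ^ homDim n)⁻¹) ENNReal.ofReal_ne_top
  rw [← h2, hemb.memLp_map_measure_iff] at h3
  exact h3

/-- By a change of variables in the test identity, `c⁻¹ T g ∘ δ_T` is a second weak derivative of
`u`; uniqueness identifies it with `g`. -/
theorem IsWeakFrameDeriv.ae_dilation {T c : ℝ} (hT : 0 < T) (hc : c ≠ 0) {j : Fin n ⊕ Fin n}
    {u g : Heis n → ℝ} (hg : IsWeakFrameDeriv {0}ᶜ j u g)
    (hu : ∀ᵐ p : Heis n, u (dilation T p) = c * u p) :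
    ∀ᵐ p : Heis n, g (dilation T p) = c * T⁻¹ * g p := by
  have hw : IsWeakFrameDeriv {0}ᶜ j u fun p => c⁻¹ * T * g (dilation T p) := by
    refine ⟨fun K hK hKU => (hg.1.comp_dilation hT K hK hKU).const_mul _, fun φ hφ hφc hφU => ?_⟩
    set ψ : Heis n → ℝ := fun x => φ (dilation T⁻¹ x) with hψ
    have hTinv : ∀ p : Heis n, dilation T⁻¹ (dilation T p) = p := fun p => by
      rw [dilation_dilation, inv_mul_cancel₀ hT.ne', dilation_one]
    have hφψ : ∀ p, φ p = ψ (dilation T p) := fun p => by rw [hψ]; simp only [hTinv]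
    have hψd : ContDiff ℝ ∞ ψ := hφ.comp (contDiff_dilation T⁻¹)
    have hψs : tsupport ψ ⊆ {0}ᶜ := by
      have h1 : tsupport ψ ⊆ dilation T⁻¹ ⁻¹' tsupport φ :=
        tsupport_comp_subset_preimage φ (contDiff_dilation (k := 0) T⁻¹).continuous
      intro p hp hp0
      have h2 := hφU (h1 hp)
      rw [mem_singleton_iff] at hp0
      exact h2 (by rw [hp0]; simp [dilation_eq])
    have h := hg.2 ψ hψd (hφc.comp_homeomorph (dilationHomeomorph T⁻¹ (inv_ne_zero hT.ne'))) hψs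
    have e1 : ∫ p, u p * frameDeriv j φ p =
        c⁻¹ * T * ∫ p, u (dilation T p) * frameDeriv j ψ (dilation T p) := by
      rw [← integral_const_mul]
      refine integral_congr_ae (hu.mono fun p hp => ?_)
      have h3 : frameDeriv j φ p = T * frameDeriv j ψ (dilation T p) := by
        rw [← frameDeriv_comp_dilation (hψd.differentiable (by simp))]
        congr 1
        funext x; exact hφψ x
      simp only [hp, h3]
      field_simp
    have e2 : ∫ p, c⁻¹ * T * g (dilation T p) * φ p =
        c⁻¹ * T * ∫ p, g (dilation T p) * ψ (dilation T p) := by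
      rw [← integral_const_mul]
      exact integral_congr_ae (Eventually.of_forall fun p => by simp only [← hφψ, mul_assoc])
    rw [e1, e2, integral_dilation T hT (fun p => u p * frameDeriv j ψ p),
      integral_dilation T hT (fun p => g p * ψ p), h]
    ring
  have h0 : ∀ᵐ p : Heis n, p ≠ 0 := by
    rw [ae_iff]; simp
  filter_upwards [hg.ae_eq isOpen_compl_singleton hw, h0] with p hp hp0
  rw [hp hp0]
  field_simp

/-! ### Weights of degree `-Q` -/

/-- The half open shell `{a ≤ |x| < b}`. -/
def shell (n : ℕ) (a b : ℝ) : Set (Heis n) := {p | a ≤ homNorm p ∧ homNorm p < b}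

theorem measurableSet_shell (a b : ℝ) : MeasurableSet (shell n a b) :=
  continuous_homNorm.measurable measurableSet_Ico

/-- The Jacobian `T^Q` of the dilation cancels the degree `-Q` of the weight. -/
theorem lintegral_shell_dilation {T : ℝ} (hT : 0 < T) {W : Heis n → ℝ≥0∞}
    (hW : ∀ᵐ p : Heis n, W (dilation T p) = ENNReal.ofReal (T ^ homDim n)⁻¹ * W p) (a b : ℝ) :
    ∫⁻ p in shell n (T * a) (T * b), W p = ∫⁻ p in shell n a b, W p := by
  have hs : ∀ p : Heis n, dilation T p ∈ shell n (T * a) (T * b) ↔ p ∈ shell n a b := by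
    intro p
    change _ ∧ _ ↔ _ ∧ _
    rw [homNorm_dilation hT, mul_le_mul_iff_right₀ hT, mul_lt_mul_iff_right₀ hT]
  have h1 := lintegral_dilation T hT ((shell n (T * a) (T * b)).indicator W)
  have h2 : ∫⁻ p, (shell n (T * a) (T * b)).indicator W (dilation T p) =
      ENNReal.ofReal (T ^ homDim n)⁻¹ * ∫⁻ p in shell n a b, W p := by
    rw [← lintegral_indicator (measurableSet_shell a b),
      ← lintegral_const_mul' _ _ ENNReal.ofReal_ne_top]
    refine lintegral_congr_ae (hW.mono fun p hp => ?_)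
    by_cases h : p ∈ shell n a b
    · simp only [indicator_of_mem ((hs p).2 h), indicator_of_mem h, hp]
    · simp only [indicator_of_notMem (fun h' => h ((hs p).1 h')), indicator_of_notMem h, mul_zero]
  rw [h2, lintegral_indicator (measurableSet_shell _ _)] at h1
  have hpos : 0 < (T ^ homDim n)⁻¹ := by positivity
  exact ((ENNReal.mul_right_inj (by simpa using hpos) ENNReal.ofReal_ne_top).1 h1).symm

theorem lintegral_shell_pow {T : ℝ} (hT : 1 < T) {W : Heis n → ℝ≥0∞}
    (hW : ∀ᵐ p : Heis n, W (dilation T p) = ENNReal.ofReal (T ^ homDim n)⁻¹ * W p) (a m : ℕ) :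
    ∫⁻ p in shell n (T ^ a) (T ^ (a + m)), W p = m * ∫⁻ p in shell n 1 T, W p := by
  have hT0 : 0 < T := by linarith
  have h1 : ∀ k : ℕ, ∫⁻ p in shell n (T ^ k) (T ^ (k + 1)), W p = ∫⁻ p in shell n 1 T, W p := by
    intro k
    induction k with
    | zero => simp
    | succ k ih => rw [← ih, ← lintegral_shell_dilation hT0 hW (T ^ k) (T ^ (k + 1)),
        ← pow_succ', ← pow_succ']
  induction m with
  | zero =>
    have : shell n (T ^ a) (T ^ (a + 0)) = ∅ := by
      ext p; simp only [shell, add_zero]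
      exact ⟨fun h => absurd h.1 (not_le.2 h.2), fun h => h.elim⟩
    rw [this]; simp
  | succ m ih =>
    have hU : shell n (T ^ a) (T ^ (a + (m + 1))) =
        shell n (T ^ a) (T ^ (a + m)) ∪ shell n (T ^ (a + m)) (T ^ (a + m + 1)) := by
      have e1 : T ^ a ≤ T ^ (a + m) := pow_le_pow_right₀ hT.le (by omega)
      have e2 : T ^ (a + m) ≤ T ^ (a + m + 1) := pow_le_pow_right₀ hT.le (by omega)
      ext p
      exact Set.ext_iff.1 (Ico_union_Ico_eq_Ico e1 e2).symm (homNorm p)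
    have hd : Disjoint (shell n (T ^ a) (T ^ (a + m)))
        (shell n (T ^ (a + m)) (T ^ (a + m + 1))) :=
      Set.disjoint_left.2 fun p h1 h2 => absurd h1.2 (not_lt.2 h2.1)
    rw [hU, lintegral_union (measurableSet_shell _ _) hd, ih, h1]
    push_cast; ring

theorem shell_subset (a b : ℝ) :
    shell n a b ⊆ {p | a ≤ homNorm p ∧ homNorm p ≤ b} := fun _ hp => ⟨hp.1, hp.2.le⟩

theorem closedShell_subset_compl {a b : ℝ} (ha : 0 < a) :
    {p : Heis n | a ≤ homNorm p ∧ homNorm p ≤ b} ⊆ {0}ᶜ := by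
  intro p hp h0
  rw [mem_singleton_iff, ← homNorm_eq_zero_iff] at h0
  linarith [hp.1]

theorem MemL2loc.memLp_shell {f : Heis n → ℝ} (hf : MemL2loc {0}ᶜ f) {a b : ℝ} (ha : 0 < a) :
    MemLp f 2 (volume.restrict (shell n a b)) :=
  (hf _ (isCompact_shell a b) (closedShell_subset_compl ha)).mono_measure
    (Measure.restrict_mono (shell_subset a b) le_rfl)

theorem lintegral_sq_ne_top_of_memLp {μ : Measure (Heis n)} {f : Heis n → ℝ} (hf : MemLp f 2 μ) :
    ∫⁻ p, ‖f p‖ₑ ^ 2 ∂μ ≠ ⊤ := by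
  rw [← sq_eLpNorm_two]
  exact ENNReal.pow_ne_top hf.2.ne

/-! ### Hölder's inequality and the Sobolev inequality with a cutoff -/

theorem holderConjugate_half (hn : 1 ≤ n) :
    (sobExp n / 2).HolderConjugate ((homDim n : ℝ) / 2) := by
  have hq := sobExp_pos hn
  have hQ := four_le_homDim hn
  have h := two_div_sobExp hn
  rw [Real.holderConjugate_iff]
  refine ⟨?_, ?_⟩
  · have h1 : 0 < 2 / (homDim n : ℝ) := by positivity
    have h2 : 2 / sobExp n < 1 := by linarith
    rw [div_lt_one hq] at h2
    linarith
  · rw [inv_div, inv_div, h]; ring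

/-- Integrating the weight `|x|^{-Q}` over a shell gives logarithmic growth. -/
theorem lintegral_shell_weight_le (n : ℕ) :
    ∃ J : ℝ, 1 ≤ J ∧ ∀ l : ℝ, 1 ≤ l →
      ∫⁻ p in shell n 1 (Real.exp (3 * l)), ENNReal.ofReal (homNorm p ^ homDim n)⁻¹ ≤
        ENNReal.ofReal (J * l) := by
  set W : Heis n → ℝ≥0∞ := fun p => ENNReal.ofReal (homNorm p ^ homDim n)⁻¹ with hWdef
  have hW : ∀ᵐ p : Heis n, W (dilation (Real.exp 1) p) =
      ENNReal.ofReal (Real.exp 1 ^ homDim n)⁻¹ * W p := Eventually.of_forall fun p => by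
    simp only [hWdef]
    rw [homNorm_dilation (Real.exp_pos 1), mul_pow, mul_inv, ENNReal.ofReal_mul (by positivity)]
  have hfin : ∫⁻ p in shell n 1 (Real.exp 1), W p ≠ ⊤ := by
    have h1 : ∫⁻ p in shell n 1 (Real.exp 1), W p ≤ ∫⁻ p in shell n 1 (Real.exp 1), 1 := by
      refine setLIntegral_mono' (measurableSet_shell _ _) fun p hp => ?_
      rw [← ENNReal.ofReal_one]
      exact ENNReal.ofReal_le_ofReal (inv_le_one_of_one_le₀ (one_le_pow₀ hp.1))
    refine ne_top_of_le_ne_top ?_ h1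
    rw [setLIntegral_one]
    exact ((measure_mono (shell_subset _ _)).trans_lt
      (isCompact_shell _ _).measure_lt_top).ne
  set J := (∫⁻ p in shell n 1 (Real.exp 1), W p).toReal with hJ
  have hJ0 : 0 ≤ J := ENNReal.toReal_nonneg
  -- The shell is covered by `⌈3l⌉ ≤ 4l` shells of ratio `e`, each with integral `J`; the summand
  -- `1` makes the constant at least one.
  refine ⟨4 * J + 1, by linarith, fun l hl => ?_⟩
  have hceil := Nat.ceil_lt_add_one (show 0 ≤ 3 * l by linarith)
  calc _ ≤ ∫⁻ p in shell n (Real.exp 1 ^ 0) (Real.exp 1 ^ (0 + ⌈3 * l⌉₊)), W p := by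
        refine lintegral_mono_set fun p hp => ⟨?_, hp.2.trans_le ?_⟩
        · rw [pow_zero]; exact hp.1
        · rw [zero_add, ← Real.exp_nat_mul, mul_one]
          exact Real.exp_le_exp.2 (Nat.le_ceil _)
    _ = ENNReal.ofReal (⌈3 * l⌉₊ * J) := by
        rw [lintegral_shell_pow (by simp) hW, ENNReal.ofReal_mul (by positivity),
          ENNReal.ofReal_natCast, hJ, ENNReal.ofReal_toReal hfin]
    _ ≤ _ := by
        refine ENNReal.ofReal_le_ofReal ?_
        nlinarith

/-- Hölder with exponents `q/2` and `Q/2`: raised to the power `Q/2`, the weight `|x|⁻²` becomes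
`|x|^{-Q}`, whose integral grows linearly in `l`. -/
theorem lintegral_shell_holder (hn : 1 ≤ n) :
    ∃ J : ℝ, 1 ≤ J ∧ ∀ l : ℝ, 1 ≤ l → ∀ u : Heis n → ℝ, MemL2loc {0}ᶜ u →
      ∫⁻ p in shell n 1 (Real.exp (3 * l)), ‖u p‖ₑ ^ 2 * ENNReal.ofReal (homNorm p ^ 2)⁻¹ ≤
        ENNReal.ofReal (J * l) *
          (∫⁻ p in shell n 1 (Real.exp (3 * l)), ‖u p‖ₑ ^ sobExp n) ^ (2 / sobExp n) := by
  obtain ⟨J, hJ1, hJ⟩ := lintegral_shell_weight_le n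
  have hQ := four_le_homDim hn
  refine ⟨J, hJ1, fun l hl u hu => ?_⟩
  have hum := (hu.memLp_shell (a := 1) (b := Real.exp (3 * l)) one_pos).1.enorm
  have hNm : Measurable fun p : Heis n => ENNReal.ofReal (homNorm p ^ 2)⁻¹ :=
    ((continuous_homNorm.measurable.pow_const 2).inv).ennreal_ofReal
  have h := ENNReal.lintegral_mul_le_Lp_mul_Lq (volume.restrict (shell n 1 (Real.exp (3 * l))))
    (holderConjugate_half hn) (hum.pow_const 2) hNm.aemeasurable
  refine h.trans ?_
  rw [mul_comm, one_div_div, one_div_div]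
  refine mul_le_mul' ?_ (le_of_eq ?_)
  · have h1 : ∀ p : Heis n, ENNReal.ofReal (homNorm p ^ 2)⁻¹ ^ ((homDim n : ℝ) / 2) =
        ENNReal.ofReal (homNorm p ^ homDim n)⁻¹ := by
      intro p
      have hN := homNorm_nonneg p
      rw [ENNReal.ofReal_rpow_of_nonneg (by positivity) (by positivity),
        Real.inv_rpow (by positivity), ← Real.rpow_natCast _ 2, ← Real.rpow_mul hN,
        ← Real.rpow_natCast _ (homDim n)]
      congr 3
      push_cast; ring
    simp only [h1]
    refine (ENNReal.rpow_le_rpow (hJ l hl) (by positivity)).trans ?_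
    rw [ENNReal.ofReal_rpow_of_nonneg (by positivity) (by positivity)]
    refine ENNReal.ofReal_le_ofReal ?_
    -- Hölder gives the power `2/Q` of `J l`. Rounding it up to the first power is harmless, since
    -- the cutoff brings `l⁻²`.
    have h2 : 1 ≤ J * l := by nlinarith
    calc (J * l) ^ (2 / (homDim n : ℝ)) ≤ (J * l) ^ (1 : ℝ) := by
          refine Real.rpow_le_rpow_of_exponent_le h2 ?_
          rw [div_le_one (by linarith)]; linarith
      _ = J * l := Real.rpow_one _
  · congr 1
    refine lintegral_congr fun p => ?_
    rw [← ENNReal.rpow_two, ← ENNReal.rpow_mul]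
    congr 1; ring

theorem add_sq_le_ennreal (a b : ℝ≥0∞) : (a + b) ^ 2 ≤ 2 * a ^ 2 + 2 * b ^ 2 := by
  have h := ENNReal.rpow_add_le_mul_rpow_add_rpow a b (one_le_two (α := ℝ))
  simp only [ENNReal.rpow_two] at h
  norm_num at h
  rwa [mul_add] at h

/-- The Sobolev inequality for the product of `u` and a logarithmic cutoff. -/
theorem sobolev_logCutoff (hn : 1 ≤ n) :
    ∃ C : ℝ, 0 < C ∧ ∀ l : ℝ, 1 ≤ l → ∀ (u : Heis n → ℝ) (g : Fin n ⊕ Fin n → Heis n → ℝ),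
      MemL2loc {0}ᶜ u → (∀ j, IsWeakFrameDeriv {0}ᶜ j u (g j)) →
      (∫⁻ p in shell n (Real.exp l) (Real.exp (2 * l)), ‖u p‖ₑ ^ sobExp n) ^ (2 / sobExp n) ≤
        ENNReal.ofReal C * (∫⁻ p in shell n 1 (Real.exp (3 * l)), ∑ j, ‖g j p‖ₑ ^ 2) +
        ENNReal.ofReal (C / l ^ 2) * ∫⁻ p in shell n 1 (Real.exp (3 * l)),
          ‖u p‖ₑ ^ 2 * ENNReal.ofReal (homNorm p ^ 2)⁻¹ := by
  obtain ⟨C, hC, hsob⟩ := sobolev_weak hn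
  obtain ⟨B, hB, hη'⟩ := exists_frameDeriv_logCutoff_bound n
  have hn0 : (0 : ℝ) < n := by exact_mod_cast hn
  have hq := sobExp_pos hn
  refine ⟨2 * C + C * (2 * n) * (2 * B ^ 2), by positivity, fun l hl u g hu hg => ?_⟩
  have hl0 : 0 < l := by linarith
  set S := shell n 1 (Real.exp (3 * l)) with hS
  have hSm : MeasurableSet S := measurableSet_shell _ _
  let η : Heis n → ℝ := logCutoff l
  have hηd : ContDiff ℝ ∞ η := contDiff_logCutoff hl0
  have hηc : HasCompactSupport η := hasCompactSupport_logCutoff hl0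
  have hηU : tsupport η ⊆ {0}ᶜ :=
    (tsupport_logCutoff_subset hl0).trans (closedShell_subset_compl one_pos)
  have hnot : ∀ p, p ∉ S → homNorm p < 1 ∨ Real.exp (3 * l) ≤ homNorm p := by
    intro p hp
    by_contra h
    push Not at h
    exact hp ⟨h.1, h.2⟩
  have hη0 : ∀ p, p ∉ S → η p = 0 := fun p hp =>
    logCutoff_eq_zero hl0 ((hnot p hp).imp_left le_of_lt)
  have hηd0 : ∀ j p, p ∉ S → frameDeriv j η p = 0 := fun j p hp =>
    frameDeriv_logCutoff_eq_zero hl0 j (hnot p hp)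
  have hus : MemLp u 2 (volume.restrict S) := hu.memLp_shell one_pos
  have hgs : ∀ j, MemLp (g j) 2 (volume.restrict S) := fun j => (hg j).1.memLp_shell one_pos
  have hv : MemLp (fun p => η p * u p) 2 := by
    have h1 : MemLp (fun p => η p * u p) 2 (volume.restrict S) := by
      refine hus.mono (hηd.continuous.aestronglyMeasurable.mul hus.1)
        (Eventually.of_forall fun p => ?_)
      rw [norm_mul, Real.norm_of_nonneg (logCutoff_nonneg l p)]
      exact mul_le_of_le_one_left (norm_nonneg _) (logCutoff_le_one l p)
    rw [← memLp_indicator_iff_restrict hSm] at h1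
    refine (memLp_congr_ae (Eventually.of_forall fun p => ?_)).1 h1
    by_cases hp : p ∈ S
    · rw [indicator_of_mem hp]
    · simp [indicator_of_notMem hp, hη0 p hp]
  have hgc : ∀ j, Continuous (frameDeriv j η) := continuous_frameDeriv (hηd.of_le (by simp))
  have hgm : ∀ j, AEStronglyMeasurable fun p => η p * g j p + u p * frameDeriv j η p := by
    intro j
    have h1 : AEStronglyMeasurable (fun p => η p * g j p + u p * frameDeriv j η p)
        (volume.restrict S) :=
      (hηd.continuous.aestronglyMeasurable.mul (hgs j).1).add
        (hus.1.mul (hgc j).aestronglyMeasurable)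
    rw [← aestronglyMeasurable_indicator_iff hSm] at h1
    refine h1.congr (Eventually.of_forall fun p => ?_)
    by_cases hp : p ∈ S
    · rw [indicator_of_mem hp]
    · simp [indicator_of_notMem hp, hη0 p hp, hηd0 j p hp]
  have h := hsob (fun p => η p * u p) (fun j p => η p * g j p + u p * frameDeriv j η p)
    hηc.mul_right hv hgm fun j φ hφ _ =>
      (hg j).integral_cutoff isOpen_compl_singleton hu hηd hηc hηU hφ
  have hlow : ∫⁻ p in shell n (Real.exp l) (Real.exp (2 * l)), ‖u p‖ₑ ^ sobExp n ≤
      ∫⁻ p, ‖η p * u p‖ₑ ^ sobExp n := by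
    refine le_trans (le_of_eq ?_) (setLIntegral_le_lintegral
      (shell n (Real.exp l) (Real.exp (2 * l))) _)
    refine setLIntegral_congr_fun (measurableSet_shell _ _) fun p hp => ?_
    have h1 : η p = 1 := logCutoff_eq_one hl0 hp.1 hp.2.le
    simp only [h1, one_mul]
  set P := ∫⁻ p in S, ‖u p‖ₑ ^ 2 * ENNReal.ofReal (homNorm p ^ 2)⁻¹ with hP
  -- Both summands vanish off `S`; on `S` one uses `(a + b)² ≤ 2a² + 2b²`, `0 ≤ η ≤ 1` and the bound
  -- `B / (l |x|)` for the derivative of `η`.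
  have hterm : ∀ j, ∫⁻ p, ‖η p * g j p + u p * frameDeriv j η p‖ₑ ^ 2 ≤
      2 * (∫⁻ p in S, ‖g j p‖ₑ ^ 2) + ENNReal.ofReal (2 * B ^ 2 / l ^ 2) * P := by
    intro j
    have h1 : ∫⁻ p, ‖η p * g j p + u p * frameDeriv j η p‖ₑ ^ 2 =
        ∫⁻ p in S, ‖η p * g j p + u p * frameDeriv j η p‖ₑ ^ 2 := by
      rw [← lintegral_indicator hSm]
      refine lintegral_congr fun p => ?_
      by_cases hp : p ∈ S
      · rw [indicator_of_mem hp]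
      · simp [indicator_of_notMem hp, hη0 p hp, hηd0 j p hp]
    rw [h1, hP, ← lintegral_const_mul' 2 _ (by simp), ← lintegral_const_mul' _ _
      ENNReal.ofReal_ne_top, ← lintegral_add_left' (((hgs j).1.enorm.pow_const 2).const_mul 2)]
    refine setLIntegral_mono' hSm fun p hp => ?_
    have hN : 1 ≤ homNorm p := hp.1
    have hp0 : p ≠ 0 := fun h0 => by
      rw [(homNorm_eq_zero_iff p).2 h0] at hN; linarith
    have hηe : ‖η p‖ₑ ≤ 1 := by
      rw [← ofReal_norm, ← ENNReal.ofReal_one, Real.norm_of_nonneg (logCutoff_nonneg l p)]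
      exact ENNReal.ofReal_le_ofReal (logCutoff_le_one l p)
    have hde : ‖frameDeriv j η p‖ₑ ≤ ENNReal.ofReal (B / (l * homNorm p)) := by
      rw [← ofReal_norm]
      exact ENNReal.ofReal_le_ofReal (hη' l hl0 j p hp0)
    calc _ ≤ (‖g j p‖ₑ + ‖u p‖ₑ * ENNReal.ofReal (B / (l * homNorm p))) ^ 2 := by
          gcongr
          refine (enorm_add_le _ _).trans ?_
          rw [enorm_mul, enorm_mul]
          exact add_le_add (mul_le_of_le_one_left' hηe) (mul_le_mul_right hde _)
      _ ≤ 2 * ‖g j p‖ₑ ^ 2 + 2 * (‖u p‖ₑ * ENNReal.ofReal (B / (l * homNorm p))) ^ 2 :=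
          add_sq_le_ennreal _ _
      _ = _ := by
          congr 1
          rw [mul_pow, ← ENNReal.ofReal_pow (by positivity)]
          have h2 : (B / (l * homNorm p)) ^ 2 = B ^ 2 / l ^ 2 * (homNorm p ^ 2)⁻¹ := by
            field_simp
          have h3 : 2 * B ^ 2 / l ^ 2 = 2 * (B ^ 2 / l ^ 2) := by ring
          rw [h2, h3, ENNReal.ofReal_mul (by positivity), ENNReal.ofReal_mul (by positivity),
            ENNReal.ofReal_ofNat]
          ring
  calc _ ≤ (∫⁻ p, ‖η p * u p‖ₑ ^ sobExp n) ^ (2 / sobExp n) :=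
        ENNReal.rpow_le_rpow hlow (by positivity)
    _ ≤ ENNReal.ofReal C * ∑ j, (2 * (∫⁻ p in S, ‖g j p‖ₑ ^ 2) +
          ENNReal.ofReal (2 * B ^ 2 / l ^ 2) * P) :=
        h.trans (mul_le_mul_right (Finset.sum_le_sum fun j _ => hterm j) _)
    _ = ENNReal.ofReal (2 * C) * (∫⁻ p in S, ∑ j, ‖g j p‖ₑ ^ 2) +
          ENNReal.ofReal (C * (2 * n) * (2 * B ^ 2) / l ^ 2) * P := by
        rw [lintegral_finsetSum' _ fun j _ => (hgs j).1.enorm.pow_const 2,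
          Finset.sum_add_distrib, ← Finset.mul_sum, Finset.sum_const, mul_add]
        congr 1
        · rw [mul_comm 2 C, ENNReal.ofReal_mul hC.le, ENNReal.ofReal_ofNat, mul_assoc]
        · have h4 : C * (2 * n) * (2 * B ^ 2) / l ^ 2 = C * ((2 * n : ℕ) * (2 * B ^ 2 / l ^ 2)) := by
            push_cast; ring
          rw [h4, ENNReal.ofReal_mul hC.le, ENNReal.ofReal_mul (p := ((2 * n : ℕ) : ℝ))
            (by positivity), ENNReal.ofReal_natCast, nsmul_eq_mul]
          simp only [Finset.card_univ, Fintype.card_sum, Fintype.card_fin, ← two_mul]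
          ring
    _ ≤ _ := by
        have hpos : 0 ≤ C * (2 * n) * (2 * B ^ 2) := by positivity
        gcongr
        · linarith
        · linarith

/-! ### Periodicity of the two densities and the inequality on one period -/

theorem isWeakFrameDeriv_weakGrad {U : Set (Heis n)} {u : Heis n → ℝ} (hu : MemS1loc U u)
    (j : Fin n ⊕ Fin n) : IsWeakFrameDeriv U j u (weakGrad U u j) := by
  rw [weakGrad, dif_pos (hu.2 j)]
  exact (hu.2 j).choose_spec

/-- The critical exponent satisfies `q (Q - 2) / 2 = Q`. -/
theorem sobolev_weight_dilation (hn : 1 ≤ n) {T : ℝ} (hT : 1 < T) {u : Heis n → ℝ}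
    (hu : u ∈ XSpace n T) :
    ∀ᵐ p : Heis n, ‖u (dilation T p)‖ₑ ^ sobExp n =
      ENNReal.ofReal (T ^ homDim n)⁻¹ * ‖u p‖ₑ ^ sobExp n := by
  have hT0 : 0 < T := by linarith
  have hq := sobExp_pos hn
  have hQ := four_le_homDim hn
  filter_upwards [hu.2] with p hp
  rw [hp, enorm_mul, ENNReal.mul_rpow_of_nonneg _ _ hq.le, ← ofReal_norm (T ^ _),
    Real.norm_of_nonneg (by positivity), ENNReal.ofReal_rpow_of_nonneg (by positivity) hq.le,
    ← Real.rpow_mul hT0.le]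
  congr 2
  have h1 : -(((homDim n : ℝ) - 2) / 2) * sobExp n = -(homDim n : ℝ) := by
    have h2 : (homDim n : ℝ) - 2 ≠ 0 := by linarith
    rw [sobExp]; field_simp
  rw [h1, Real.rpow_neg hT0.le, Real.rpow_natCast]

/-- A derivative lowers the degree `-(Q-2)/2` by one to `-Q/2`, and the square has degree `-Q`. -/
theorem gradient_weight_dilation {T : ℝ} (hT : 1 < T) {u : Heis n → ℝ} (hu : u ∈ XSpace n T) :
    ∀ᵐ p : Heis n, ∑ j, ‖weakGrad {0}ᶜ u j (dilation T p)‖ₑ ^ 2 =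
      ENNReal.ofReal (T ^ homDim n)⁻¹ * ∑ j, ‖weakGrad {0}ᶜ u j p‖ₑ ^ 2 := by
  have hT0 : 0 < T := by linarith
  have h1 : ∀ᵐ p : Heis n, ∀ j, weakGrad {0}ᶜ u j (dilation T p) =
      T ^ (-(((homDim n : ℝ) - 2) / 2)) * T⁻¹ * weakGrad {0}ᶜ u j p := by
    rw [ae_all_iff]
    intro j
    exact (isWeakFrameDeriv_weakGrad hu.1 j).ae_dilation hT0 (by positivity) hu.2
  filter_upwards [h1] with p hp
  rw [Finset.mul_sum]
  refine Finset.sum_congr rfl fun j _ => ?_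
  rw [hp j, enorm_mul, mul_pow, ← ofReal_norm (_ * T⁻¹), Real.norm_of_nonneg (by positivity),
    ← ENNReal.ofReal_pow (by positivity)]
  congr 2
  rw [← Real.rpow_neg_one T, ← Real.rpow_add hT0, ← Real.rpow_natCast, ← Real.rpow_mul hT0.le,
    ← Real.rpow_natCast T, ← Real.rpow_neg hT0.le]
  congr 1
  push_cast; ring

/-- The inequality over a fundamental shell, with `K` periods used for the cutoff. -/
theorem sobolev_fundamental_shell (hn : 1 ≤ n) :
    ∃ A C : ℝ, 1 ≤ A ∧ 0 < C ∧ ∀ T : ℝ, 1 < T → ∀ u ∈ XSpace n T, ∀ K : ℕ, A ≤ K * Real.log T →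
      (∫⁻ p in shell n 1 T, ‖u p‖ₑ ^ sobExp n) ^ (2 / sobExp n) ≤
        ENNReal.ofReal (C * (K : ℝ) ^ (2 / (homDim n : ℝ))) *
          ∫⁻ p in shell n 1 T, ∑ j, ‖weakGrad {0}ᶜ u j p‖ₑ ^ 2 := by
  obtain ⟨C, hC, hcut⟩ := sobolev_logCutoff hn
  obtain ⟨J, hJ1, hhol⟩ := lintegral_shell_holder hn
  have hq := sobExp_pos hn
  have hQ := four_le_homDim hn
  have hqQ := two_div_sobExp hn
  -- This `A` gives both `l ≥ 1` and `3CJ / l ≤ 1/2`, the smallness needed for absorption.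
  refine ⟨1 + 6 * C * J, 6 * C, by nlinarith, by positivity, fun T hT u hu K hK => ?_⟩
  have hT0 : 0 < T := by linarith
  set l := K * Real.log T with hl
  have hCJ : 0 < C * J := by positivity
  have hl1 : 1 ≤ l := by nlinarith
  have hl0 : 0 < l := by linarith
  have hK0 : 0 < (K : ℝ) := by
    rcases Nat.eq_zero_or_pos K with h | h
    · rw [hl, h] at hl0; simp at hl0
    · exact_mod_cast h
  have hexp : ∀ m : ℕ, Real.exp (m * l) = T ^ (m * K) := by
    intro m
    rw [hl, ← mul_assoc, ← Nat.cast_mul, Real.exp_nat_mul, Real.exp_log hT0]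
  have e1 : Real.exp l = T ^ K := by simpa using hexp 1
  have e2 : Real.exp (2 * l) = T ^ (K + K) := by simpa [two_mul] using hexp 2
  have e3 : Real.exp (3 * l) = T ^ (0 + 3 * K) := by simpa using hexp 3
  have hg := isWeakFrameDeriv_weakGrad hu.1
  have h1 := hcut l hl1 u (weakGrad {0}ᶜ u) hu.1.1 hg
  have h2 := hhol l hl1 u hu.1.1
  have hgS : ∫⁻ p in shell n 1 (Real.exp (3 * l)), ∑ j, ‖weakGrad {0}ᶜ u j p‖ₑ ^ 2 ≠ ⊤ := by
    rw [lintegral_finsetSum' _ fun j _ => ((hg j).1.memLp_shell one_pos).1.enorm.pow_const 2]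
    exact ENNReal.sum_ne_top.2 fun j _ =>
      lintegral_sq_ne_top_of_memLp ((hg j).1.memLp_shell one_pos)
  have huS : ∫⁻ p in shell n 1 (Real.exp (3 * l)),
      ‖u p‖ₑ ^ 2 * ENNReal.ofReal (homNorm p ^ 2)⁻¹ ≠ ⊤ := by
    refine ne_top_of_le_ne_top (lintegral_sq_ne_top_of_memLp
      (hu.1.1.memLp_shell (a := 1) (b := Real.exp (3 * l)) one_pos)) ?_
    refine setLIntegral_mono' (measurableSet_shell _ _) fun p hp => ?_
    refine mul_le_of_le_one_right' ?_
    rw [← ENNReal.ofReal_one]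
    exact ENNReal.ofReal_le_ofReal (inv_le_one_of_one_le₀ (one_le_pow₀ hp.1))
  have hwu := sobolev_weight_dilation hn hT hu
  have hwg := gradient_weight_dilation hT hu
  set M := ∫⁻ p in shell n 1 T, ‖u p‖ₑ ^ sobExp n with hM
  set ν := ∫⁻ p in shell n 1 T, ∑ j, ‖weakGrad {0}ᶜ u j p‖ₑ ^ 2 with hν
  have s1 : ∫⁻ p in shell n (Real.exp l) (Real.exp (2 * l)), ‖u p‖ₑ ^ sobExp n = K * M := by
    rw [e1, e2]; exact lintegral_shell_pow hT hwu K K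
  have s2 : ∫⁻ p in shell n 1 (Real.exp (3 * l)), ‖u p‖ₑ ^ sobExp n = 3 * (K * M) := by
    have h := lintegral_shell_pow (W := fun p => ‖u p‖ₑ ^ sobExp n) hT hwu 0 (3 * K)
    rw [pow_zero] at h
    rw [e3, h]; push_cast; ring
  have s3 : ∫⁻ p in shell n 1 (Real.exp (3 * l)), ∑ j, ‖weakGrad {0}ᶜ u j p‖ₑ ^ 2 =
      3 * (K * ν) := by
    have h := lintegral_shell_pow (W := fun p => ∑ j, ‖weakGrad {0}ᶜ u j p‖ₑ ^ 2) hT hwg 0 (3 * K)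
    rw [pow_zero] at h
    rw [e3, h]; push_cast; ring
  set X := ((K : ℝ≥0∞) * M) ^ (2 / sobExp n) with hX
  rw [s1] at h1
  -- Subtracting `X / 2` below requires `X` finite. That follows from the cutoff inequality itself,
  -- whose right side involves only local `L²` norms away from the origin.
  have hXtop : X ≠ ⊤ := by
    refine ne_top_of_le_ne_top ?_ h1
    exact ENNReal.add_ne_top.2 ⟨ENNReal.mul_ne_top ENNReal.ofReal_ne_top hgS,
      ENNReal.mul_ne_top ENNReal.ofReal_ne_top huS⟩
  have h3 : (3 * ((K : ℝ≥0∞) * M)) ^ (2 / sobExp n) ≤ 3 * X := by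
    rw [ENNReal.mul_rpow_of_nonneg _ _ (by positivity)]
    refine mul_le_mul_left ?_ _
    calc (3 : ℝ≥0∞) ^ (2 / sobExp n) ≤ 3 ^ (1 : ℝ) := by
          refine ENNReal.rpow_le_rpow_of_exponent_le (by norm_num) ?_
          have : 0 < 2 / (homDim n : ℝ) := by positivity
          linarith
      _ = 3 := ENNReal.rpow_one _
  rw [s2] at h2
  rw [s3] at h1
  have h4 : X ≤ ENNReal.ofReal (3 * C) * (K * ν) + X / 2 := by
    refine h1.trans (add_le_add (le_of_eq ?_) ?_)
    · rw [mul_comm 3 C, ENNReal.ofReal_mul hC.le, ENNReal.ofReal_ofNat, mul_assoc]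
    · calc _ ≤ ENNReal.ofReal (C / l ^ 2) * (ENNReal.ofReal (J * l) * (3 * X)) :=
            mul_le_mul_right (h2.trans (mul_le_mul_right h3 _)) _
        _ = ENNReal.ofReal (3 * C * J / l) * X := by
            have h5 : 3 * C * J / l = C / l ^ 2 * (J * l * 3) := by field_simp
            rw [h5, ENNReal.ofReal_mul (p := C / l ^ 2) (by positivity),
              ENNReal.ofReal_mul (p := J * l) (q := 3) (by positivity), ENNReal.ofReal_ofNat]
            ring
        _ ≤ ENNReal.ofReal (1 / 2) * X := by
            refine mul_le_mul_left (ENNReal.ofReal_le_ofReal ?_) _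
            rw [div_le_iff₀ hl0]
            nlinarith
        _ = X / 2 := by
            rw [one_div, ENNReal.ofReal_inv_of_pos two_pos, ENNReal.ofReal_ofNat, mul_comm]; rfl
  have h5 : X / 2 ≤ ENNReal.ofReal (3 * C) * (K * ν) := by
    have h6 : X / 2 + X / 2 ≤ ENNReal.ofReal (3 * C) * (K * ν) + X / 2 := by
      rwa [ENNReal.add_halves]
    exact (ENNReal.add_le_add_iff_right (ENNReal.div_ne_top hXtop two_ne_zero)).1 h6
  have h6 : X ≤ ENNReal.ofReal (6 * C) * (K * ν) := by
    rw [← ENNReal.add_halves X, show 6 * C = 3 * C + 3 * C by ring,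
      ENNReal.ofReal_add (by positivity) (by positivity), add_mul]
    exact add_le_add h5 h5
  have hKe : (K : ℝ≥0∞) = ENNReal.ofReal K := (ENNReal.ofReal_natCast K).symm
  rw [hX, ENNReal.mul_rpow_of_nonneg _ _ (by positivity), hKe,
    ENNReal.ofReal_rpow_of_pos hK0] at h6
  have hKpos : 0 < (K : ℝ) ^ (2 / sobExp n) := by positivity
  -- The left side contains `K^{2/q}` and the right side `K`; as `1 - 2/q = 2/Q`, dividing leaves
  -- `K^{2/Q}`.
  have h7 : ENNReal.ofReal ((K : ℝ) ^ (2 / sobExp n)) * M ^ (2 / sobExp n) ≤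
      ENNReal.ofReal ((K : ℝ) ^ (2 / sobExp n)) *
        (ENNReal.ofReal (6 * C * (K : ℝ) ^ (2 / (homDim n : ℝ))) * ν) := by
    refine h6.trans (le_of_eq ?_)
    rw [← mul_assoc, ← mul_assoc, ← ENNReal.ofReal_mul (by positivity),
      ← ENNReal.ofReal_mul (by positivity)]
    congr 2
    have h8 : (K : ℝ) = (K : ℝ) ^ (2 / sobExp n) * (K : ℝ) ^ (2 / (homDim n : ℝ)) := by
      rw [← Real.rpow_add hK0, hqQ]; simp
    calc 6 * C * (K : ℝ) = 6 * C * ((K : ℝ) ^ (2 / sobExp n) * (K : ℝ) ^ (2 / (homDim n : ℝ))) := by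
          rw [← h8]
      _ = _ := by ring
  rwa [ENNReal.mul_le_mul_iff_right (by simpa using hKpos) ENNReal.ofReal_ne_top] at h7

/-! ### The norm of `X_T`, the number of periods and the conclusion -/

theorem lintegral_gradient_shell_le {T : ℝ} {u : Heis n → ℝ} (hu : u ∈ XSpace n T) :
    ∫⁻ p in shell n 1 T, ∑ j, ‖weakGrad {0}ᶜ u j p‖ₑ ^ 2 ≤ ENNReal.ofReal (XInner T u u) := by
  have hg := isWeakFrameDeriv_weakGrad hu.1
  have hL : ∀ j, MemLp (weakGrad {0}ᶜ u j) 2 (volume.restrict (annulus n T)) := fun j =>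
    (hg j).1 _ (isCompact_shell 1 T) (closedShell_subset_compl one_pos)
  -- `XInner` is a Bochner integral, so integrability has to be checked to exclude its default value
  -- zero.
  have hi : Integrable (fun p => ∑ j, weakGrad {0}ᶜ u j p * weakGrad {0}ᶜ u j p)
      (volume.restrict (annulus n T)) :=
    integrable_finsetSum _ fun j _ => (hL j).integrable_mul (hL j)
  rw [XInner, ofReal_integral_eq_lintegral_ofReal hi (Eventually.of_forall fun p =>
    Finset.sum_nonneg fun j _ => mul_self_nonneg _)]
  refine (lintegral_mono_set (shell_subset 1 T)).trans (le_of_eq (lintegral_congr fun p => ?_))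
  rw [ENNReal.ofReal_sum_of_nonneg fun j _ => mul_self_nonneg _]
  refine Finset.sum_congr rfl fun j _ => ?_
  rw [← ofReal_norm, ← ENNReal.ofReal_pow (norm_nonneg _), Real.norm_eq_abs, sq_abs, sq]

/-- Covering the closed annulus by two half open periods costs a factor `2` and makes it unnecessary
to know that the sphere `|x| = T` is null. -/
theorem lintegral_annulus_le {T : ℝ} (hT : 1 < T) {W : Heis n → ℝ≥0∞}
    (hW : ∀ᵐ p : Heis n, W (dilation T p) = ENNReal.ofReal (T ^ homDim n)⁻¹ * W p) :
    ∫⁻ p in annulus n T, W p ≤ 2 * ∫⁻ p in shell n 1 T, W p := by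
  have h := lintegral_shell_pow hT hW 0 2
  rw [pow_zero] at h
  refine le_trans (lintegral_mono_set fun p hp => ?_) (h.le.trans (by norm_num))
  exact ⟨hp.1, hp.2.trans_lt (lt_self_pow₀ hT (by norm_num))⟩

/-- The number of periods is controlled by the constant of the inequality. -/
theorem ceil_rpow_le (hn : 1 ≤ n) {A : ℝ} (hA : 1 ≤ A) {T : ℝ} (hT : 1 < T) :
    (⌈A / Real.log T⌉₊ : ℝ) ^ (1 / (homDim n : ℝ)) ≤
      (2 * A) ^ (1 / (homDim n : ℝ)) * (homDim n : ℝ) ^ (1 / 2 : ℝ) *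
        (Real.log T ^ (((homDim n : ℝ) - 2) / (2 * (homDim n : ℝ))) *
          (T ^ homDim n / (T ^ homDim n - 1)) ^ (1 / 2 : ℝ)) := by
  have hQ := four_le_homDim hn
  have hQ0 : 0 < (homDim n : ℝ) := by linarith
  have hL : 0 < Real.log T := Real.log_pos hT
  have hT0 : 0 < T := by linarith
  set Q : ℝ := (homDim n : ℝ) with hQdef
  set L := Real.log T with hLdef
  have hTQ : 1 < T ^ homDim n := one_lt_pow₀ hT (by simp [homDim])
  set F := T ^ homDim n / (T ^ homDim n - 1) with hF
  have hF1 : 1 ≤ F := by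
    rw [hF, le_div_iff₀ (by linarith)]; linarith
  -- This is `1 - e^{-QL} ≤ QL`, because `F⁻¹ = 1 - T^{-Q}`.
  have hFL : (Q * L)⁻¹ ≤ F := by
    rw [hF, inv_le_comm₀ (by positivity) (by linarith [hF1]), inv_div, div_le_iff₀ (by linarith)]
    have h1 : Real.exp (Q * L) = T ^ homDim n := by
      rw [hQdef, Real.exp_nat_mul, hLdef, Real.exp_log hT0]
    have h2 := Real.add_one_le_exp (-(Q * L))
    rw [Real.exp_neg, h1] at h2
    have h3 : (T ^ homDim n)⁻¹ * T ^ homDim n = 1 := inv_mul_cancel₀ (by positivity)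
    nlinarith
  have hD : 1 ≤ (2 * A) ^ (1 / Q) * Q ^ (1 / 2 : ℝ) := by
    have h1 : 1 ≤ (2 * A) ^ (1 / Q) := Real.one_le_rpow (by linarith) (by positivity)
    have h2 : 1 ≤ Q ^ (1 / 2 : ℝ) := Real.one_le_rpow (by linarith) (by norm_num)
    nlinarith
  have hexp : (Q - 2) / (2 * Q) = 1 / 2 - 1 / Q := by field_simp
  have hexp0 : 0 ≤ (Q - 2) / (2 * Q) := div_nonneg (by linarith) (by linarith)
  -- For `L ≤ A` the ceiling is at most `2A / L`, and `L^{-1/Q} = L^{1/2 - 1/Q} L^{-1/2}`, whose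
  -- last factor is controlled by `F^{1/2}`. For `L ≥ A ≥ 1` the ceiling is at most one and every
  -- factor on the right is at least one.
  rcases le_total L A with hLA | hLA
  · have hK : (⌈A / L⌉₊ : ℝ) ≤ 2 * A * L⁻¹ := by
      have h1 := (Nat.ceil_lt_add_one (show 0 ≤ A / L by positivity)).le
      have h2 : 1 ≤ A / L := by rwa [le_div_iff₀ hL, one_mul]
      have h3 : 2 * A * L⁻¹ = A / L + A / L := by ring
      linarith
    calc (⌈A / L⌉₊ : ℝ) ^ (1 / Q) ≤ (2 * A * L⁻¹) ^ (1 / Q) := by gcongr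
      _ = (2 * A) ^ (1 / Q) * Q ^ (1 / 2 : ℝ) *
          (L ^ ((Q - 2) / (2 * Q)) * ((Q * L)⁻¹) ^ (1 / 2 : ℝ)) := by
          rw [Real.mul_rpow (by positivity) (by positivity), Real.inv_rpow hL.le, hexp,
            Real.inv_rpow (by positivity), Real.mul_rpow hQ0.le hL.le, Real.rpow_sub hL]
          have : Q ^ (1 / 2 : ℝ) ≠ 0 := by positivity
          have : L ^ (1 / 2 : ℝ) ≠ 0 := by positivity
          field_simp
      _ ≤ _ := by gcongr
  · have hK : (⌈A / L⌉₊ : ℝ) ≤ 1 := by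
      have : ⌈A / L⌉₊ ≤ 1 := by
        rw [Nat.ceil_le, Nat.cast_one, div_le_one hL]; exact hLA
      exact_mod_cast this
    calc (⌈A / L⌉₊ : ℝ) ^ (1 / Q) ≤ 1 := Real.rpow_le_one (by positivity) hK (by positivity)
      _ ≤ _ := by
        have h1 : 1 ≤ L ^ ((Q - 2) / (2 * Q)) := Real.one_le_rpow (hA.trans hLA) hexp0
        have h2 : 1 ≤ F ^ (1 / 2 : ℝ) := Real.one_le_rpow hF1 (by norm_num)
        have h3 : 1 ≤ L ^ ((Q - 2) / (2 * Q)) * F ^ (1 / 2 : ℝ) := by nlinarith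
        nlinarith

end Heisenberg

theorem mainTheorem4 (n : ℕ) (hn : 1 ≤ n) :
    ∃ C : ℝ, 0 < C ∧ ∀ T : ℝ, 1 < T → ∀ u ∈ Heisenberg.XSpace n T,
      eLpNorm u
          (ENNReal.ofReal
            (2 * (Heisenberg.homDim n : ℝ) / ((Heisenberg.homDim n : ℝ) - 2)))
          (volume.restrict (Heisenberg.annulus n T)) ≤
        ENNReal.ofReal
          (C * Real.log T ^
              (((Heisenberg.homDim n : ℝ) - 2) / (2 * (Heisenberg.homDim n : ℝ))) *
            (T ^ Heisenberg.homDim n / (T ^ Heisenberg.homDim n - 1)) ^ (1 / 2 : ℝ) *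
            Heisenberg.XNorm T u) := by
  open Heisenberg in
  obtain ⟨A, C, hA, hC, hmain⟩ := sobolev_fundamental_shell hn
  have hq := sobExp_pos hn
  have hQ := four_le_homDim hn
  set D : ℝ := (2 * A) ^ (1 / (homDim n : ℝ)) * (homDim n : ℝ) ^ (1 / 2 : ℝ) with hD
  have hD0 : 0 < D := by positivity
  -- The `2` comes from covering the annulus by two periods, after `2^{2/q} ≤ 2`; `D` comes from
  -- `ceil_rpow_le`.
  refine ⟨√(2 * C) * D, by positivity, fun T hT u hu => ?_⟩
  have hlog : 0 < Real.log T := Real.log_pos hT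
  set K := ⌈A / Real.log T⌉₊ with hK
  have hKA : A ≤ K * Real.log T := by
    rw [← div_le_iff₀ hlog]; exact Nat.le_ceil _
  have h1 := (hmain T hT u hu K hKA).trans (mul_le_mul_right (lintegral_gradient_shell_le hu) _)
  have h2 := lintegral_annulus_le (W := fun p => ‖u p‖ₑ ^ sobExp n) hT (sobolev_weight_dilation hn hT hu)
  have hqQ := two_div_sobExp hn
  have hX0 : 0 ≤ XInner T u u :=
    integral_nonneg fun p => Finset.sum_nonneg fun j _ => mul_self_nonneg _
  change eLpNorm u (ENNReal.ofReal (sobExp n)) _ ≤ _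
  rw [eLpNorm_eq_lintegral_rpow_enorm_toReal (by simpa using hq) ENNReal.ofReal_ne_top,
    ENNReal.toReal_ofReal hq.le]
  calc (∫⁻ p in annulus n T, ‖u p‖ₑ ^ sobExp n) ^ (1 / sobExp n)
      ≤ (2 * ∫⁻ p in shell n 1 T, ‖u p‖ₑ ^ sobExp n) ^ (1 / sobExp n) :=
        ENNReal.rpow_le_rpow h2 (by positivity)
    _ = (2 ^ (2 / sobExp n) *
        (∫⁻ p in shell n 1 T, ‖u p‖ₑ ^ sobExp n) ^ (2 / sobExp n)) ^ (1 / 2 : ℝ) := by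
        rw [← ENNReal.mul_rpow_of_nonneg _ _ (by positivity), ← ENNReal.rpow_mul]
        congr 1; ring
    _ ≤ (2 * (ENNReal.ofReal (C * (K : ℝ) ^ (2 / (homDim n : ℝ))) *
        ENNReal.ofReal (XInner T u u))) ^ (1 / 2 : ℝ) := by
        refine ENNReal.rpow_le_rpow (mul_le_mul' ?_ h1) (by norm_num)
        calc (2 : ℝ≥0∞) ^ (2 / sobExp n) ≤ 2 ^ (1 : ℝ) := by
              refine ENNReal.rpow_le_rpow_of_exponent_le (by norm_num) ?_
              have : 0 < 2 / (homDim n : ℝ) := by positivity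
              linarith
          _ = 2 := ENNReal.rpow_one _
    _ = ENNReal.ofReal (√(2 * C) * (K : ℝ) ^ (1 / (homDim n : ℝ)) * XNorm T u) := by
        rw [← ENNReal.ofReal_mul (by positivity), ← ENNReal.ofReal_ofNat 2,
          ← ENNReal.ofReal_mul (by norm_num), ENNReal.ofReal_rpow_of_nonneg (by positivity)
          (by norm_num), XNorm, Real.sqrt_eq_rpow, Real.sqrt_eq_rpow]
        congr 1
        rw [← mul_assoc, ← mul_assoc, Real.mul_rpow (by positivity) hX0,
          Real.mul_rpow (by positivity) (by positivity), ← Real.rpow_mul (by positivity)]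
        congr 3
        ring
    _ ≤ _ := by
        refine ENNReal.ofReal_le_ofReal ?_
        have h3 := ceil_rpow_le hn hA hT
        rw [← hK, ← hD] at h3
        refine mul_le_mul_of_nonneg_right ?_ (Real.sqrt_nonneg _)
        refine (mul_le_mul_of_nonneg_left h3 (Real.sqrt_nonneg _)).trans (le_of_eq ?_)
        ring
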